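/- Let $p$ be a prime and let $R$ be a commutative Noetherian ring of characteristic $p$. For an ideal $\mathfrak a$ of a commutative ring $A$ of characteristic $p$ let $\mathfrak a^{[p^n]}$ be the ideal generated by the $p^n$-th powers of elements of $\mathfrak a$; let $A^\circ$ be the complement in $A$ of the union of its minimal primes; let the tight closure $\mathfrak a^*$ be the set of $r\in A$ such that for some $c\in A^\circ$ one has $cr^{p^n}\in\mathfrak a^{[p^n]}$ for all $n\gg0$; and let the $F$-closure $\mathfrak a^F$ be the set of $r\in A$ with $r^{p^n}\in\mathfrak a^{[p^n]}$ for some $n\ge 0$. (For the zero ring, $A^\circ=A$ and the tight closure of the only ideal is $A$.) A $p^{m_0}$-weak test element for $R$ is an element $c\in R^\circ$ such that, for every ideal $\mathfrak b$ of $R$ and every $r\in R$, $r\in\mathfrak b^*$ if and only if $cr^{p^n}\in\mathfrak b^{[p^n]}$ for all $n\ge m_0$. Let $f\colon R\to R$, $f(r)=r^p$, be the Frobenius homomorphism, and let $R^\infty$ be the perfect closure of $R$, that is, the universal perfect ring of characteristic $p$ with a homomorphism from $R$; let $\psi_n\colon R\to R^\infty$ send $r$ to the unique $p^n$-th root of the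 image of $r$. An $f$-sequence is a sequence $(\mathfrak a_n)_{n\ge0}$ of ideals of $R$ with $f^{-1}(\mathfrak a_{n+1})=\mathfrak a_n$ for all $n\ge 0$; it corresponds to the ideal $\mathfrak A$ of $R^\infty$ if $\psi_n^{-1}(\mathfrak A)=\mathfrak a_n$ for all $n\ge0$ (there is exactly one such $\mathfrak A$). An $f$-sequence $(\mathfrak a_n)$ of proper ideals has linear growth of primary decompositions if there is a positive integer $h$ such that every $\mathfrak a_n$ has a minimal primary decomposition $\mathfrak a_n=\mathfrak q_{1,n}\cap\dots\cap\mathfrak q_{k_n,n}$ with $\bigl(\sqrt{\mathfrak q_{i,n}}^{\,[p^n]}\bigr)^h\subseteq\mathfrak q_{i,n}$ for all $i$. A ring $B$ containing $A$ as a subring is a purely inseparable extension of $A$ if every element of $B$ has a $p^n$-th power in $A$ for some $n\ge0$. A subring $A$ of $B$ is pure if $M\otimes_AA\to M\otimes_AB$ is injective for every $A$-module $M$. Theorem. Let $R''$ be a pure subring of a regular commutative Noetherian ring of characteristic $p$, and assume that either $R$ is (isomorphic to) a purely inseparable extension ring of $R''$ or $R''$ is (isomorphic to) a purely inseparable extension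 ring of $R$. Let $\mathfrak a$ be a proper ideal of $R$. Then (i) every finitely generated proper ideal of $R^\infty$ has a primary decomposition; (ii) $\bigl((\mathfrak a^{[p^n]})^F\bigr)_{n\ge0}$ is an $f$-sequence of proper ideals and has linear growth of primary decompositions; (iii) the set $\bigcup_{n\ge0}\operatorname{Ass}_R\bigl(R/(\mathfrak a^{[p^n]})^F\bigr)$ is finite. If, furthermore, $R$ has a $p^{m_0}$-weak test element for some $m_0\ge0$, then (iv) $\mathfrak a^*S^{-1}R=(\mathfrak aS^{-1}R)^*$ for every multiplicatively closed subset $S$ of $R$ (with $1\in S$); (v) $\bigl((\mathfrak a^{[p^n]})^*\bigr)_{n\ge0}$ is an $f$-sequence of proper ideals, the ideal of $R^\infty$ to which it corresponds has a primary decomposition, and this $f$-sequence has linear growth of primary decompositions; (vi) $\bigcup_{n\ge0}\operatorname{Ass}_R\bigl(R/(\mathfrak a^{[p^n]})^*\bigr)\subseteq\bigcup_{n\ge0}\operatorname{Ass}_R\bigl(R/(\mathfrak a^{[p^n]})^F\bigr)$, and the set $\bigcup_{n\ge0}\operatorname{Ass}_R\bigl(R/(\mathfrak a^{[p^n]})^*\bigr)$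 is finite. -/

import Mathlib

universe u v

/-- `A → B` is a pure homomorphism of commutative rings: for every `A`-module `M` the natural map
`M ⊗ A → M ⊗ B` is injective. (An element of `M` which dies in `M ⊗ B` already dies in `N ⊗ B` for
some finitely generated submodule `N` of `M`, and finitely generated `A`-modules live in the
universe of `A` up to isomorphism, so modules in that universe suffice.) In particular `A → B` is
injective, so that `A` is a pure subring of `B`. -/
def IsPureSubring (A : Type u) (B : Type v) [CommRing A] [CommRing B] [Algebra A B] : Prop :=
  ∀ (M : Type u) [AddCommGroup M] [Module A M],
    Function.Injective (LinearMap.lTensor M (Algebra.linearMap A B))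

/-- The ring homomorphism `i : A → B` makes `B` a purely inseparable extension ring of `A`:
it is injective and each element of `B` has a `p ^ n`-th power in (the image of) `A`. -/
def IsPurelyInsepExtension (p : ℕ) {A : Type u} {B : Type v} [CommRing A] [CommRing B]
    (i : A →+* B) : Prop :=
  Function.Injective i ∧ ∀ b : B, ∃ n : ℕ, b ^ p ^ n ∈ i.range

/-- The ideal `I` is the intersection of finitely many primary ideals
(primary ideals are proper by definition). -/
def HasPrimaryDecomposition {A : Type u} [CommRing A] (I : Ideal A) : Prop :=
  ∃ s : Finset (Ideal A), (∀ q ∈ s, q.IsPrimary) ∧ s.inf id = I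

/-- The Frobenius power `𝔞^[p^n]`: the ideal generated by the `p^n`-th powers of elements of `𝔞`. -/
def frobPower {A : Type u} [CommRing A] (p n : ℕ) (𝔞 : Ideal A) : Ideal A :=
  Ideal.span ((fun r => r ^ p ^ n) '' (𝔞 : Set A))

/-- `A°`, the complement of the union of the minimal prime ideals of `A`. -/
def minCompl (A : Type u) [CommRing A] : Set A :=
  {c | ∀ P ∈ minimalPrimes A, c ∉ P}

/-- The set of elements of the tight closure of `𝔞`. It is defined for every commutative ring, so
that it makes sense for a ring of fractions of a ring of characteristic `p`, zero ring included. -/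
def tightClosureSet {A : Type u} [CommRing A] (p : ℕ) (𝔞 : Ideal A) : Set A :=
  {r | ∃ c ∈ minCompl A, ∃ N : ℕ, ∀ n ≥ N, c * r ^ p ^ n ∈ frobPower p n 𝔞}

theorem mul_mem_minCompl {A : Type u} [CommRing A] {c d : A} (hc : c ∈ minCompl A)
    (hd : d ∈ minCompl A) : c * d ∈ minCompl A := by
  intro P hP h
  rcases hP.1.1.mem_or_mem h with h | h
  · exact hc P hP h
  · exact hd P hP h

theorem one_mem_minCompl {A : Type u} [CommRing A] : (1 : A) ∈ minCompl A :=
  fun _ hP h => hP.1.1.ne_top ((Ideal.eq_top_iff_one _).2 h)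

theorem pow_mem_frobPower_add {A : Type u} [CommRing A] {p : ℕ} {𝔞 : Ideal A} {r : A} {n : ℕ}
    (h : r ^ p ^ n ∈ frobPower p n 𝔞) (hp : p.Prime) [CharP A p] (k : ℕ) :
    r ^ p ^ (n + k) ∈ frobPower p (n + k) 𝔞 := by
  have := Fact.mk hp
  have key : frobPower p n 𝔞 ≤ (frobPower p (n + k) 𝔞).comap (iterateFrobenius A p k) := by
    refine Ideal.span_le.2 ?_
    rintro _ ⟨x, hx, rfl⟩
    refine Ideal.subset_span ⟨x, hx, ?_⟩
    simp only [iterateFrobenius_def, ← pow_mul, ← pow_add]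
  have := key h
  rwa [Ideal.mem_comap, iterateFrobenius_def, ← pow_mul, ← pow_add] at this

section CharP

variable {R : Type u} [CommRing R] (p : ℕ) [Fact p.Prime] [CharP R p]

/-- The tight closure `𝔞^*` of an ideal of a ring of characteristic `p`. -/
def tightClosure (𝔞 : Ideal R) : Ideal R where
  carrier := tightClosureSet p 𝔞
  zero_mem' := ⟨1, one_mem_minCompl, 0, fun n _ => by
    rw [zero_pow (pow_ne_zero n (Fact.out : p.Prime).ne_zero), mul_zero]
    exact Ideal.zero_mem _⟩
  add_mem' := by
    rintro x y ⟨c, hc, N, h⟩ ⟨d, hd, M, h'⟩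
    refine ⟨c * d, mul_mem_minCompl hc hd, max N M, fun n hn => ?_⟩
    rw [add_pow_char_pow]
    have e : c * d * (x ^ p ^ n + y ^ p ^ n) = d * (c * x ^ p ^ n) + c * (d * y ^ p ^ n) := by ring
    rw [e]
    exact Ideal.add_mem _
      (Ideal.mul_mem_left _ _ (h n ((le_max_left _ _).trans hn)))
      (Ideal.mul_mem_left _ _ (h' n ((le_max_right _ _).trans hn)))
  smul_mem' := by
    rintro a x ⟨c, hc, N, h⟩
    refine ⟨c, hc, N, fun n hn => ?_⟩
    have e : c * (a • x) ^ p ^ n = a ^ p ^ n * (c * x ^ p ^ n) := by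
      rw [smul_eq_mul, mul_pow]; ring
    rw [e]
    exact Ideal.mul_mem_left _ _ (h n hn)

/-- The `F`-closure `𝔞^F` of an ideal of a ring of characteristic `p`. -/
def frobClosure (𝔞 : Ideal R) : Ideal R where
  carrier := {r | ∃ n : ℕ, r ^ p ^ n ∈ frobPower p n 𝔞}
  zero_mem' := ⟨0, by simp⟩
  add_mem' := by
    rintro x y ⟨n, h⟩ ⟨m, h'⟩
    refine ⟨n + m, ?_⟩
    rw [add_pow_char_pow]
    refine Ideal.add_mem _ (pow_mem_frobPower_add h Fact.out m) ?_
    rw [add_comm n m]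
    exact pow_mem_frobPower_add h' Fact.out n
  smul_mem' := by
    rintro a x ⟨n, h⟩
    refine ⟨n, ?_⟩
    rw [smul_eq_mul, mul_pow]
    exact Ideal.mul_mem_left _ _ h

/-- An `f`-sequence of ideals: the Frobenius preimage of each term is the preceding term. -/
def IsFSequence (I : ℕ → Ideal R) : Prop :=
  ∀ n, (I (n + 1)).comap (frobenius R p) = I n

/-- `I` is an `f`-sequence of proper ideals which has linear growth of primary decompositions:
for some positive `h`, each `I n` has a minimal primary decomposition in which every component `q`
contains the `h`-th power of the `n`-th Frobenius power of its radical. -/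
def HasLinearGrowth (I : ℕ → Ideal R) : Prop :=
  IsFSequence p I ∧ (∀ n, I n ≠ ⊤) ∧
    ∃ h : ℕ, 0 < h ∧ ∀ n, ∃ t : Finset (Ideal R),
      Submodule.IsMinimalPrimaryDecomposition (I n) t ∧ ∀ q ∈ t, (frobPower p n q.radical) ^ h ≤ q

/-- `c` is a `p^m₀`-weak test element for `R`. -/
def IsWeakTestElement (m₀ : ℕ) (c : R) : Prop :=
  c ∈ minCompl R ∧ ∀ (𝔟 : Ideal R) (r : R),
    r ∈ tightClosure p 𝔟 ↔ ∀ n ≥ m₀, c * r ^ p ^ n ∈ frobPower p n 𝔟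

/-- The ring homomorphism from `R` to its perfect closure which sends `r` to the unique
`p^n`-th root of the image of `r`. -/
noncomputable def rootHom (n : ℕ) : R →+* PerfectClosure R p :=
  ((iterateFrobeniusEquiv (PerfectClosure R p) p n).symm : _ →+* _).comp (PerfectClosure.of R p)

/-- The ideal `𝔄` of the perfect closure corresponds to the sequence `I` of ideals of `R`:
`I n` consists of the elements of `R` whose `p^n`-th root lies in `𝔄`. -/
def CorrespondsTo (𝔄 : Ideal (PerfectClosure R p)) (I : ℕ → Ideal R) : Prop :=
  ∀ n, 𝔄.comap (rootHom p n) = I n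

theorem rootHom_apply (n : ℕ) (r : R) : rootHom p n r = PerfectClosure.mk R p (n, r) := by
  change (iterateFrobeniusEquiv (PerfectClosure R p) p n).symm (PerfectClosure.of R p r) = _
  rw [RingEquiv.symm_apply_eq, iterateFrobeniusEquiv_apply, coe_iterateFrobenius,
    PerfectClosure.iterate_frobenius_mk]

/-- An ideal of the perfect closure is determined by the sequence to which it corresponds. -/
theorem CorrespondsTo.unique {𝔄 𝔅 : Ideal (PerfectClosure R p)} {I : ℕ → Ideal R}
    (hA : CorrespondsTo p 𝔄 I) (hB : CorrespondsTo p 𝔅 I) : 𝔄 = 𝔅 := by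
  ext x
  obtain ⟨⟨n, r⟩, rfl⟩ := PerfectClosure.mk_surjective R p x
  rw [← rootHom_apply, ← Ideal.mem_comap, ← Ideal.mem_comap, hA n, hB n]

end CharP

/-! ### Regular local rings are domains. -/

section RegularLocal

open IsLocalRing

/-! All the ideals (𝔞^[p^n])^F are traces of one ideal: r lies in the n-th one exactly when ψ_n(r) ∈
𝔞R^∞ (`rootHom_mem_map_of`). Hence a single primary decomposition of 𝔞R^∞ controls every n, although
R^∞ need not be Noetherian.

Existence of the decomposition: over a regular ring T the Frobenius is flat
(`isPowFlat_of_isRegularRing`), so Frobenius powers respect finite intersections and colons, and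
extension to T^∞ turns primary decompositions into primary decompositions
(`hasPrimaryDecomposition_map_of`). By purity every ideal of R'' is contracted from T, hence every
finitely generated ideal of R''^∞ is contracted from T^∞ and inherits a decomposition
(`hasPrimaryDecomposition_of_comap_map_le`). Finally R and R'' have isomorphic perfect closures.

Consequences: contracting the components along ψ_n gives radicals independent of n and one exponent
for all n (`hasLinearGrowth_of_correspondsTo`), and the associated primes of all the terms are the
contractions of those of the one ideal (`iUnion_associatedPrimes`). With a weak test element c, the
tight closures correspond to the ideal of all x with xψ_n(c) ∈ 𝔞R^∞ for every n
(`correspondsTo_tightClosure`); its decomposition comes from that of 𝔞R^∞ without new radicals.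
Tight closure commutes with localization because the finitely many components allow one denominator
for all n (`mem_map_tightClosure`). -/

theorem exists_isRegularLocalRing_quotient {T : Type u} [CommRing T] [IsRegularLocalRing T] {n : ℕ}
    (hn : (maximalIdeal T).spanFinrank = n + 1) {x : T} (hx : x ∈ maximalIdeal T)
    (hx2 : x ∉ maximalIdeal T ^ 2) :
    ∃ _ : IsRegularLocalRing (T ⧸ Ideal.span {x}),
      (maximalIdeal (T ⧸ Ideal.span {x})).spanFinrank = n := by
  classical
  have hle : Ideal.span {x} ≤ maximalIdeal T := (Ideal.span_singleton_le_iff_mem _).2 hx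
  have hnt : Nontrivial (T ⧸ Ideal.span {x}) :=
    Ideal.Quotient.nontrivial_iff.2 fun h =>
      (maximalIdeal.isMaximal T).ne_top (top_le_iff.1 (h ▸ hle))
  have hloc : IsLocalRing (T ⧸ Ideal.span {x}) :=
    IsLocalRing.of_surjective' _ (Ideal.Quotient.mk_surjective (I := Ideal.span {x}))
  obtain ⟨s, hcard, hs⟩ := Submodule.FG.exists_span_finset_card_eq_spanFinrank
    (maximalIdeal T).fg_of_isNoetherianRing
  rw [hn] at hcard
  have hxs : x ∈ Submodule.span T (s : Set T) := hs ▸ hx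
  obtain ⟨f, hf⟩ := (Submodule.mem_span_finset.1 hxs)
  obtain ⟨hfs, hf⟩ := hf
  have hsm : ∀ a ∈ s, a ∈ maximalIdeal T := fun a ha => hs ▸ Submodule.subset_span ha
  -- As x ∉ 𝔪², some coefficient of x on a minimal generating set is a unit; that generator becomes
  -- redundant modulo x.
  obtain ⟨b, hb, hbu⟩ : ∃ b ∈ s, IsUnit (f b) := by
    by_contra! h
    refine hx2 (hf ▸ Ideal.sum_mem _ fun a ha => ?_)
    rw [pow_two]
    exact Ideal.mul_mem_mul ((mem_maximalIdeal _).2 (h a ha)) (hsm a ha)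
  have hmap : (maximalIdeal T).map (Ideal.Quotient.mk (Ideal.span {x})) =
      maximalIdeal (T ⧸ Ideal.span {x}) := by
    have hc := IsLocalRing.eq_maximalIdeal (Ideal.comap_isMaximal_of_surjective
      (Ideal.Quotient.mk (Ideal.span {x})) Ideal.Quotient.mk_surjective
      (K := maximalIdeal (T ⧸ Ideal.span {x})))
    rw [← hc, Ideal.map_comap_of_surjective _ Ideal.Quotient.mk_surjective]
  have hspan : maximalIdeal (T ⧸ Ideal.span {x}) =
      Submodule.span _ (((s.erase b).image (Ideal.Quotient.mk (Ideal.span {x})) :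
        Finset (T ⧸ Ideal.span {x})) : Set (T ⧸ Ideal.span {x})) := by
    refine le_antisymm ?_ (Submodule.span_le.2 ?_)
    · rw [← hmap, ← hs, Ideal.map_le_iff_le_comap]
      refine Submodule.span_le.2 fun a ha => ?_
      have key : ∀ a ∈ s.erase b, Ideal.Quotient.mk (Ideal.span {x}) a ∈ Ideal.span
          (((s.erase b).image (Ideal.Quotient.mk (Ideal.span {x})) :
          Finset (T ⧸ Ideal.span {x})) : Set (T ⧸ Ideal.span {x})) := fun a ha =>
        Ideal.subset_span (Finset.mem_coe.2 (Finset.mem_image_of_mem _ ha))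
      rcases eq_or_ne a b with rfl | hab
      · have h0 : Ideal.Quotient.mk (Ideal.span {x}) (f a * a) = - ∑ i ∈ s.erase a,
            Ideal.Quotient.mk (Ideal.span {x}) (f i) * Ideal.Quotient.mk (Ideal.span {x}) i := by
          have := congrArg (Ideal.Quotient.mk (Ideal.span {x})) hf
          rw [← Finset.add_sum_erase _ _ hb, Ideal.Quotient.eq_zero_iff_mem.2
            (Ideal.mem_span_singleton_self x), map_add, map_sum] at this
          simpa [smul_eq_mul, map_mul] using eq_neg_of_add_eq_zero_left this
        obtain ⟨u, hu⟩ := hbu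
        have h1 : Ideal.Quotient.mk (Ideal.span {x}) a =
            Ideal.Quotient.mk (Ideal.span {x}) (↑u⁻¹ : T) *
              Ideal.Quotient.mk (Ideal.span {x}) (f a * a) := by
          rw [← map_mul, ← hu, Units.inv_mul_cancel_left]
        change Ideal.Quotient.mk (Ideal.span {x}) a ∈ Ideal.span _
        rw [h1, h0]
        exact Ideal.mul_mem_left _ _ (neg_mem (Ideal.sum_mem _ fun i hi =>
          Ideal.mul_mem_left _ _ (key i hi)))
      · exact key a (Finset.mem_erase.2 ⟨hab, ha⟩)
    · intro y hy
      obtain ⟨a, ha, rfl⟩ := Finset.mem_image.1 (Finset.mem_coe.1 hy)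
      rw [← hmap]
      exact Ideal.mem_map_of_mem _ (hsm a (Finset.mem_of_mem_erase ha))
  have hfin : (maximalIdeal (T ⧸ Ideal.span {x})).spanFinrank ≤ n := by
    rw [hspan]
    refine (Submodule.spanFinrank_span_le_ncard_of_finite (Finset.finite_toSet _)).trans ?_
    rw [Set.ncard_coe_finset]
    refine Finset.card_image_le.trans ?_
    rw [Finset.card_erase_of_mem hb, hcard, Nat.add_sub_cancel]
  -- Killing one element lowers the dimension by at most one, so the bound n on the number of
  -- generators is attained.
  have hdim : (n : WithBot ℕ∞) ≤ ringKrullDim (T ⧸ Ideal.span {x}) := by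
    have h1 : ringKrullDim T ≤ ringKrullDim (T ⧸ Ideal.span {x}) + 1 := by
      have := ringKrullDim_le_ringKrullDim_quotient_add_card ({x} : Finset T) (by
        rw [IsLocalRing.ringJacobson_eq_maximalIdeal]; simpa using hx)
      rw [Finset.coe_singleton] at this
      simpa using this
    rw [← IsRegularLocalRing.spanFinrank_maximalIdeal (R := T), hn, Nat.cast_add,
      Nat.cast_one] at h1
    revert h1
    cases h : ringKrullDim (T ⧸ Ideal.span {x}) with
    | bot => exact absurd h ringKrullDim_ne_bot
    | coe a =>
      intro h1
      have : ((n : ℕ∞) + 1) ≤ a + 1 := by exact_mod_cast h1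
      exact_mod_cast (ENat.add_le_add_iff_right (by simp)).1 this
  have hreg : IsRegularLocalRing (T ⧸ Ideal.span {x}) :=
    IsRegularLocalRing.of_spanFinrank_maximalIdeal_le _
      ((by exact_mod_cast hfin :
        ((maximalIdeal (T ⧸ Ideal.span {x})).spanFinrank : WithBot ℕ∞) ≤ n).trans
        hdim)
  refine ⟨hreg, le_antisymm hfin ?_⟩
  have := hdim
  rw [← IsRegularLocalRing.spanFinrank_maximalIdeal] at this
  exact_mod_cast this

theorem IsRegularLocalRing.exists_mem_notMem_minimalPrimes {T : Type u} [CommRing T]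
    [IsRegularLocalRing T] {n : ℕ} (hn : (maximalIdeal T).spanFinrank = n + 1) :
    ∃ x ∈ maximalIdeal T, x ∉ maximalIdeal T ^ 2 ∧ ∀ P ∈ minimalPrimes T, x ∉ P := by
  classical
  by_contra! h
  have hfin := minimalPrimes.finite_of_isNoetherianRing T
  have hne : maximalIdeal T ≠ ⊥ := fun h0 => by
    rw [h0, Submodule.spanFinrank_bot] at hn; omega
  have hsub : (maximalIdeal T : Set T) ⊆
      ⋃ i ∈ ((insert (maximalIdeal T ^ 2) hfin.toFinset : Finset (Ideal T)) : Set (Ideal T)),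
        (i : Set T) := by
    intro x hx
    by_cases hx2 : x ∈ maximalIdeal T ^ 2
    · exact Set.mem_biUnion (by simp) hx2
    · obtain ⟨P, hP, hxP⟩ := h x hx hx2
      exact Set.mem_biUnion (by simp [hP]) hxP
  -- Prime avoidance tolerates two non-prime ideals; 𝔪² fills both slots.
  rw [Ideal.subset_union_prime (maximalIdeal T ^ 2) (maximalIdeal T ^ 2)] at hsub
  · obtain ⟨P, hP, hle⟩ := hsub
    rcases Finset.mem_insert.1 hP with rfl | hP
    · refine hne (Submodule.eq_bot_of_le_smul_of_le_jacobson_bot (maximalIdeal T) _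
        (maximalIdeal T).fg_of_isNoetherianRing ?_ (maximalIdeal_le_jacobson _))
      rwa [smul_eq_mul, ← pow_two]
    · have hP := hfin.mem_toFinset.1 hP
      have : maximalIdeal T = P :=
        (maximalIdeal.isMaximal T).eq_of_le hP.1.1.ne_top hle
      have h0 : (maximalIdeal T).height = 0 := Ideal.height_eq_zero_iff.2 (this ▸ hP)
      have h1 := IsRegularLocalRing.spanFinrank_maximalIdeal (R := T)
      rw [← maximalIdeal_height_eq_ringKrullDim, h0, hn] at h1
      exact absurd h1 (by exact_mod_cast Nat.succ_ne_zero n)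
  · intro i hi hne _
    exact (hfin.mem_toFinset.1 ((Finset.mem_insert.1 hi).resolve_left hne)).1.1

/-- By induction (x) is prime, so it contains a minimal prime P. Since x ∉ P, each zx ∈ P has z ∈ P,
so P = xP and P = 0 by Nakayama. -/
theorem IsRegularLocalRing.isDomain_of_spanFinrank (n : ℕ) : ∀ (T : Type u) [CommRing T]
    [IsRegularLocalRing T], (maximalIdeal T).spanFinrank = n → IsDomain T := by
  induction n with
  | zero =>
    intro T _ _ hn
    rw [Submodule.spanFinrank_eq_zero_iff_eq_bot (maximalIdeal T).fg_of_isNoetherianRing] at hn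
    exact (isField_iff_maximalIdeal_eq.2 hn).isDomain
  | succ n ih =>
    intro T _ _ hn
    obtain ⟨x, hx, hx2, hxP⟩ := IsRegularLocalRing.exists_mem_notMem_minimalPrimes hn
    obtain ⟨_, hn'⟩ := exists_isRegularLocalRing_quotient hn hx hx2
    have := ih (T ⧸ Ideal.span {x}) hn'
    have hpr : (Ideal.span {x}).IsPrime := (Ideal.Quotient.isDomain_iff_prime _).1 this
    obtain ⟨P, hP, hPx⟩ := Ideal.exists_minimalPrimes_le (I := ⊥) (J := Ideal.span {x}) bot_le
    have hPp : P.IsPrime := hP.1.1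
    have hbot : P = ⊥ := by
      refine Submodule.eq_bot_of_le_smul_of_le_jacobson_bot (maximalIdeal T) _
        P.fg_of_isNoetherianRing (fun y hy => ?_) (maximalIdeal_le_jacobson _)
      obtain ⟨z, rfl⟩ := Ideal.mem_span_singleton'.1 (hPx hy)
      rw [mul_comm, smul_eq_mul]
      exact Ideal.mul_mem_mul hx ((hPp.mem_or_mem hy).resolve_right (hxP P hP))
    rw [hbot] at hPp
    have : NoZeroDivisors T := ⟨fun h => by simpa using hPp.mem_or_mem (by simpa using h)⟩
    exact NoZeroDivisors.to_isDomain T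

theorem IsRegularLocalRing.isDomain (T : Type u) [CommRing T] [IsRegularLocalRing T] :
    IsDomain T :=
  IsRegularLocalRing.isDomain_of_spanFinrank _ T rfl

end RegularLocal

/-! ### Flatness of Frobenius over regular local rings, in equational form. -/

section FrobeniusFlat

open IsLocalRing

/-- The span of the `q`-th powers of the vectors `r` with `∑ a i * r i ∈ J`. -/
def powRel {A : Type u} [CommRing A] (q : ℕ) {n : ℕ} (a : Fin n → A) (J : Ideal A) :
    Submodule A (Fin n → A) :=
  Submodule.span A {v | ∃ r : Fin n → A, ∑ i, a i * r i ∈ J ∧ v = r ^ q}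

/-- The equational form of flatness of the `q`-th power map: the relations of the `q`-th powers of
the `a i` are generated by the `q`-th powers of the relations of the `a i`. -/
def IsPowFlat (A : Type u) [CommRing A] (q : ℕ) : Prop :=
  ∀ (n : ℕ) (a c : Fin n → A), ∑ i, a i ^ q * c i = 0 → c ∈ powRel q a ⊥

/-- The `q`-th power map is additive. -/
def IsPowAdditive (A : Type u) [CommRing A] (q : ℕ) : Prop :=
  q ≠ 0 ∧ ∀ x y : A, (x + y) ^ q = x ^ q + y ^ q

variable {A : Type u} [CommRing A] {q : ℕ}

theorem IsPowAdditive.pi (h : IsPowAdditive A q) (ι : Type v) : IsPowAdditive (ι → A) q :=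
  ⟨h.1, fun x y => funext fun i => h.2 (x i) (y i)⟩

theorem IsPowAdditive.of_surjective (h : IsPowAdditive A q) {B : Type v} [CommRing B]
    (f : A →+* B) (hf : Function.Surjective f) : IsPowAdditive B q := by
  refine ⟨h.1, fun x y => ?_⟩
  obtain ⟨x, rfl⟩ := hf x
  obtain ⟨y, rfl⟩ := hf y
  rw [← map_add, ← map_pow, h.2, map_add, map_pow, map_pow]

theorem IsPowAdditive.sum_pow (h : IsPowAdditive A q) {ι : Type v} (s : Finset ι) (f : ι → A) :
    (∑ i ∈ s, f i) ^ q = ∑ i ∈ s, f i ^ q :=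
  map_sum (⟨⟨fun x => x ^ q, zero_pow h.1⟩, h.2⟩ : A →+ A) f s

theorem IsPowAdditive.sub_pow (h : IsPowAdditive A q) (x y : A) : (x - y) ^ q = x ^ q - y ^ q :=
  map_sub (⟨⟨fun x => x ^ q, zero_pow h.1⟩, h.2⟩ : A →+ A) x y

theorem isPowFlat_of_isField (hA : IsField A) (h : IsPowAdditive A q) : IsPowFlat A q := by
  classical
  intro n a c hc
  by_cases ha : ∀ i, a i = 0
  · rw [pi_eq_sum_univ' c]
    refine Submodule.sum_mem _ fun i _ => Submodule.smul_mem _ _ (Submodule.subset_span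
      ⟨Pi.single i 1, by simp [ha], ?_⟩)
    ext j
    rcases eq_or_ne i j with rfl | hij
    · simp
    · simp [hij, zero_pow h.1]
  · push Not at ha
    obtain ⟨k, hk⟩ := ha
    obtain ⟨b, hb⟩ := hA.mul_inv_cancel hk
    -- If a_k is invertible with inverse b, the relations of a are spanned by e_i - b a_i e_k; the
    -- q-th powers of these vectors, with coefficients c_i, give back c.
    have key : c = ∑ i, c i • (Pi.single i 1 - Pi.single k (b * a i) : Fin n → A) ^ q := by
      have h1 : ∀ i (x : A), (Pi.single i x : Fin n → A) ^ q = Pi.single i (x ^ q) := fun i x => by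
        ext j
        rcases eq_or_ne j i with rfl | hij
        · simp
        · simp [Pi.single_eq_of_ne hij, zero_pow h.1]
      simp_rw [(h.pi (Fin n)).sub_pow, h1, smul_sub, Finset.sum_sub_distrib]
      have h2 : ∑ i, c i • (Pi.single k ((b * a i) ^ q) : Fin n → A) = 0 := by
        ext j
        rcases eq_or_ne j k with rfl | hij
        · simp only [Finset.sum_apply, Pi.smul_apply, Pi.single_eq_same, smul_eq_mul, mul_pow,
            Pi.zero_apply]
          rw [← mul_zero (b ^ q), ← hc, Finset.mul_sum]
          exact Finset.sum_congr rfl fun i _ => by ring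
        · simp [Pi.single_eq_of_ne hij]
      rw [h2, sub_zero]
      ext j
      simp [Finset.sum_apply, Pi.single_apply]
    rw [key]
    refine Submodule.sum_mem _ fun i _ => Submodule.smul_mem _ _ (Submodule.subset_span
      ⟨_, ?_, rfl⟩)
    have : ∀ j, a j * (Pi.single i 1 - Pi.single k (b * a i) : Fin n → A) j =
        (if j = i then a j else 0) - (if j = k then a j * (b * a i) else 0) := fun j => by
      simp [Pi.single_apply, mul_sub]
    simp_rw [this, Finset.sum_sub_distrib]
    simp only [Finset.sum_ite_eq', Finset.mem_univ, if_true, Ideal.mem_bot]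
    linear_combination (-a i) * hb

/-- Lifting from A/(x) gives c = m + x d with m in the span; m is itself a relation modulo x^q, so x
can be cancelled and the step repeated on d. After q rounds the remainder x^q d is a combination of
the q-th powers of the x e_i. -/
theorem mem_powRel_of_mod [IsDomain A] {x : A} (hx : x ≠ 0) (h : IsPowAdditive A q)
    (hflat : IsPowFlat (A ⧸ Ideal.span {x}) q) {n : ℕ} {a c : Fin n → A}
    (hc : ∑ i, a i ^ q * c i ∈ Ideal.span {x ^ q}) : c ∈ powRel q a (Ideal.span {x}) := by
  have step : ∀ c : Fin n → A, ∑ i, a i ^ q * c i ∈ Ideal.span {x} →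
      ∃ m ∈ powRel q a (Ideal.span {x}), ∃ d : Fin n → A, c = m + x • d := by
    intro c hc
    set f := Ideal.Quotient.mk (Ideal.span {x})
    have h1 := hflat n (fun i => f (a i)) (fun i => f (c i)) (by
      have := Ideal.Quotient.eq_zero_iff_mem.2 hc
      simpa [map_sum, f] using this)
    have h2 : ∀ v ∈ powRel q (fun i => f (a i)) ⊥, ∃ m ∈ powRel q a (Ideal.span {x}),
        v = fun i => f (m i) := by
      intro v hv
      induction hv using Submodule.span_induction with
      | mem v hv =>
        obtain ⟨r, hr, rfl⟩ := hv
        choose r' hr' using fun i => Ideal.Quotient.mk_surjective (r i)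
        refine ⟨r' ^ q, Submodule.subset_span ⟨r', ?_, rfl⟩, ?_⟩
        · rw [← Ideal.Quotient.eq_zero_iff_mem, map_sum]
          simpa [f, hr'] using hr
        · ext i; simp [f, hr']
      | zero => exact ⟨0, zero_mem _, by ext; simp⟩
      | add v w _ _ hv hw =>
        obtain ⟨m, hm, rfl⟩ := hv
        obtain ⟨m', hm', rfl⟩ := hw
        exact ⟨m + m', add_mem hm hm', by ext; simp⟩
      | smul t v _ hv =>
        obtain ⟨m, hm, rfl⟩ := hv
        obtain ⟨t, rfl⟩ := Ideal.Quotient.mk_surjective t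
        exact ⟨t • m, Submodule.smul_mem _ _ hm, by ext; simp [f]⟩
    obtain ⟨m, hm, hmc⟩ := h2 _ h1
    have h3 : ∀ i, ∃ d, d * x = c i - m i := fun i =>
      Ideal.mem_span_singleton'.1 (Ideal.Quotient.eq.1 (congrFun hmc i))
    choose d hd using h3
    refine ⟨m, hm, d, ?_⟩
    ext i
    simp only [Pi.add_apply, Pi.smul_apply, smul_eq_mul]
    linear_combination - hd i
  have hM : ∀ m ∈ powRel q a (Ideal.span {x}), ∑ i, a i ^ q * m i ∈ Ideal.span {x ^ q} := by
    intro m hm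
    induction hm using Submodule.span_induction with
    | mem v hv =>
      obtain ⟨r, hr, rfl⟩ := hv
      obtain ⟨e, he⟩ := Ideal.mem_span_singleton'.1 hr
      refine Ideal.mem_span_singleton'.2 ⟨e ^ q, ?_⟩
      rw [← mul_pow, he, h.sum_pow]
      simp [mul_pow]
    | zero => simp
    | add v w _ _ hv hw => simpa [mul_add, Finset.sum_add_distrib] using add_mem hv hw
    | smul t v _ hv =>
      have := Ideal.mul_mem_left _ t hv
      rw [Finset.mul_sum] at this
      refine (congrArg (· ∈ _) (Finset.sum_congr rfl fun i _ => ?_)).mp this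
      simp only [Pi.smul_apply, smul_eq_mul]; ring
  have hind : ∀ j ≤ q, ∃ m ∈ powRel q a (Ideal.span {x}), ∃ d : Fin n → A, c = m + x ^ j • d := by
    intro j
    induction j with
    | zero => exact fun _ => ⟨0, zero_mem _, c, by simp⟩
    | succ j ih =>
      intro hj
      obtain ⟨m, hm, d, hd⟩ := ih (by omega)
      have h1 : x ^ j * ∑ i, a i ^ q * d i ∈ Ideal.span {x ^ q} := by
        have h2 := sub_mem hc (hM m hm)
        refine (congrArg (· ∈ Ideal.span {x ^ q}) ?_).mp h2
        rw [hd, Finset.mul_sum, ← Finset.sum_sub_distrib]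
        refine Finset.sum_congr rfl fun i _ => ?_
        simp only [Pi.add_apply, Pi.smul_apply, smul_eq_mul]; ring
      obtain ⟨e, he⟩ := Ideal.mem_span_singleton'.1 h1
      -- Cancelling x^j leaves a multiple of x^(q - j), still divisible by x because j < q.
      obtain ⟨m', hm', d', rfl⟩ := step d (Ideal.mem_span_singleton'.2 ⟨e * x ^ (q - (j + 1)), by
        refine mul_left_cancel₀ (pow_ne_zero j hx) ?_
        rw [← he]
        have : x ^ q = x ^ j * x ^ (q - (j + 1)) * x := by
          rw [← pow_add, ← pow_succ]; congr 1; omega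
        rw [this]; ring⟩)
      refine ⟨m + x ^ j • m', add_mem hm (Submodule.smul_mem _ _ hm'), d', ?_⟩
      rw [hd, smul_add, smul_smul, pow_succ, add_assoc]
  classical
  obtain ⟨m, hm, d, rfl⟩ := hind q le_rfl
  refine add_mem hm ?_
  rw [pi_eq_sum_univ' d, Finset.smul_sum]
  refine Submodule.sum_mem _ fun i _ => ?_
  rw [smul_comm]
  refine Submodule.smul_mem _ _ (Submodule.subset_span ⟨Pi.single i x, ?_, ?_⟩)
  · simpa [Pi.single_apply] using Ideal.mul_mem_left _ _ (Ideal.mem_span_singleton_self x)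
  · ext j
    rcases eq_or_ne i j with rfl | hij
    · simp
    · simp [hij, zero_pow h.1]

/-- Write c = ∑ d_j r_j^q with ∑ a_i r_{j,i} = e_j x^N. Then d is a relation of the e_j^q modulo
x^q, and a vector s with ∑ e_j s_j ∈ (x) makes ∑ s_j r_j a relation of a modulo x^(N+1). -/
theorem mem_powRel_of_mod_pow [IsDomain A] {x : A} (hx : x ≠ 0) (h : IsPowAdditive A q)
    (hflat : IsPowFlat (A ⧸ Ideal.span {x}) q) (N : ℕ) {n : ℕ} {a c : Fin n → A}
    (hc : ∑ i, a i ^ q * c i ∈ Ideal.span {(x ^ N) ^ q}) :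
    c ∈ powRel q a (Ideal.span {x ^ N}) := by
  classical
  induction N with
  | zero =>
    rw [pi_eq_sum_univ' c]
    refine Submodule.sum_mem _ fun i _ => Submodule.smul_mem _ _ (Submodule.subset_span
      ⟨Pi.single i 1, by simp, ?_⟩)
    ext j
    rcases eq_or_ne i j with rfl | hij
    · simp
    · simp [hij, zero_pow h.1]
  | succ N ih =>
    obtain ⟨k, d, g, rfl⟩ := Submodule.mem_span_set'.1 (ih (by
      obtain ⟨e, he⟩ := Ideal.mem_span_singleton'.1 hc
      exact Ideal.mem_span_singleton'.2 ⟨e * x ^ q, by rw [← he]; ring⟩))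
    choose r hr hg using fun j => (g j).2
    choose e he using fun j => Ideal.mem_span_singleton'.1 (hr j)
    have h1 : d ∈ powRel q e (Ideal.span {x}) := by
      refine mem_powRel_of_mod hx h hflat ?_
      obtain ⟨t, ht⟩ := Ideal.mem_span_singleton'.1 hc
      refine Ideal.mem_span_singleton'.2 ⟨t, ?_⟩
      refine mul_left_cancel₀ (pow_ne_zero q (pow_ne_zero N hx)) ?_
      trans t * (x ^ (N + 1)) ^ q
      · ring
      rw [ht, Finset.mul_sum]
      have h2 : ∀ j, (x ^ N) ^ q * (e j ^ q * d j) = ∑ i, d j * (a i ^ q * r j i ^ q) := fun j => by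
        rw [← mul_assoc, ← mul_pow, mul_comm (x ^ N), he, h.sum_pow, mul_comm, Finset.mul_sum]
        simp [mul_pow]
      simp_rw [h2]
      rw [Finset.sum_comm]
      refine Finset.sum_congr rfl fun i _ => ?_
      rw [Finset.sum_apply, Finset.mul_sum]
      refine Finset.sum_congr rfl fun j _ => ?_
      rw [hg]; simp only [Pi.smul_apply, Pi.pow_apply, smul_eq_mul]; ring
    have hcomb : ∀ d ∈ powRel q e (Ideal.span {x}), ∑ j, d j • (g j : Fin n → A) ∈
        powRel q a (Ideal.span {x ^ (N + 1)}) := by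
      intro d hd
      induction hd using Submodule.span_induction with
      | mem v hv =>
        obtain ⟨s, hs, rfl⟩ := hv
        refine Submodule.subset_span ⟨∑ j, s j • r j, ?_, ?_⟩
        · obtain ⟨t, ht⟩ := Ideal.mem_span_singleton'.1 hs
          refine Ideal.mem_span_singleton'.2 ⟨t, ?_⟩
          rw [pow_succ', ← mul_assoc, ht, Finset.sum_mul]
          simp_rw [Finset.sum_apply, Finset.mul_sum]
          rw [Finset.sum_comm]
          refine Finset.sum_congr rfl fun j _ => ?_
          rw [mul_right_comm, he, Finset.sum_mul]
          exact Finset.sum_congr rfl fun i _ => by simp only [Pi.smul_apply, smul_eq_mul]; ring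
        · rw [(h.pi _).sum_pow]
          exact Finset.sum_congr rfl fun j _ => by rw [hg, _root_.smul_pow]; rfl
      | zero => simp
      | add v w _ _ hv hw => simpa [add_smul, Finset.sum_add_distrib] using add_mem hv hw
      | smul t v _ hv =>
        simpa [Finset.smul_sum, smul_smul] using Submodule.smul_mem _ t hv
    exact hcomb d h1

/-- Relations modulo x^(N+k) are corrected to true relations up to 𝔪^N by Artin–Rees, with k the
Artin–Rees constant of the image of r ↦ ∑ a_i r_i; Krull's intersection theorem then removes the
error. -/
theorem isPowFlat_of_quotient [IsDomain A] [IsNoetherianRing A] [IsLocalRing A] {x : A}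
    (hx : x ≠ 0) (hxm : x ∈ maximalIdeal A) (h : IsPowAdditive A q)
    (hflat : IsPowFlat (A ⧸ Ideal.span {x}) q) : IsPowFlat A q := by
  intro n a c hc
  let φ : (Fin n → A) →ₗ[A] A := Fintype.linearCombination A a
  have hφ : ∀ r, φ r = ∑ i, a i * r i := fun r => by
    simp [φ, Fintype.linearCombination_apply, mul_comm]
  obtain ⟨k, hk⟩ := Ideal.exists_pow_inf_eq_pow_smul (M := A) (Ideal.span {x}) (LinearMap.range φ)
  have key : ∀ N, c ∈ powRel q a ⊥ ⊔ (maximalIdeal A ^ N • ⊤ : Submodule A (Fin n → A)) := by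
    intro N
    have h1 := mem_powRel_of_mod_pow hx h hflat (N + k) (a := a) (c := c)
      (by rw [hc]; exact zero_mem _)
    refine (Submodule.span_le.2 ?_ : powRel q a (Ideal.span {x ^ (N + k)}) ≤ _) h1
    rintro _ ⟨r, hr, rfl⟩
    have h2 : φ r ∈ Ideal.span {x} ^ (N + k) • (⊤ : Submodule A A) ⊓ LinearMap.range φ := by
      refine ⟨?_, r, rfl⟩
      rw [hφ, Ideal.span_singleton_pow]
      simpa using hr
    rw [hk _ (Nat.le_add_left k N), Nat.add_sub_cancel, Ideal.span_singleton_pow,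
      Submodule.ideal_span_singleton_smul] at h2
    obtain ⟨y, hy, hyr⟩ := (Submodule.mem_smul_pointwise_iff_exists _ _ _).1 h2
    obtain ⟨s, rfl⟩ := hy.2
    have h3 : r ^ q = (r - x ^ N • s) ^ q + (x ^ N • s) ^ q := by
      rw [(h.pi _).sub_pow, sub_add_cancel]
    rw [h3]
    refine Submodule.add_mem_sup (Submodule.subset_span ⟨_, ?_, rfl⟩) ?_
    · rw [← hφ, map_sub, map_smul, ← hyr, sub_self]; exact zero_mem _
    · rw [_root_.smul_pow]
      refine Submodule.smul_mem_smul ?_ trivial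
      exact Ideal.pow_mem_of_mem _ (Ideal.pow_mem_pow hxm N) q (Nat.pos_of_ne_zero h.1)
  have hK := Ideal.iInf_pow_smul_eq_bot_of_isLocalRing (R := A) (M := (Fin n → A) ⧸ powRel q a ⊥)
    (maximalIdeal A) (maximalIdeal.isMaximal A).ne_top
  rw [← Submodule.Quotient.mk_eq_zero, ← Submodule.mem_bot A, ← hK, Submodule.mem_iInf]
  intro N
  obtain ⟨u, hu, v, hv, rfl⟩ := Submodule.mem_sup.1 (key N)
  rw [Submodule.Quotient.mk_add, (Submodule.Quotient.mk_eq_zero _).2 hu, zero_add]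
  have := Submodule.mem_map_of_mem (f := (powRel q a ⊥).mkQ) hv
  rw [Submodule.map_smul''] at this
  exact Submodule.smul_mono le_rfl le_top this

theorem isPowFlat_of_spanFinrank (q : ℕ) (n : ℕ) : ∀ (T : Type u) [CommRing T]
    [IsRegularLocalRing T],
    (maximalIdeal T).spanFinrank = n → IsPowAdditive T q → IsPowFlat T q := by
  induction n with
  | zero =>
    intro T _ _ hn h
    rw [Submodule.spanFinrank_eq_zero_iff_eq_bot (maximalIdeal T).fg_of_isNoetherianRing] at hn
    exact isPowFlat_of_isField (isField_iff_maximalIdeal_eq.2 hn) h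
  | succ n ih =>
    intro T _ _ hn h
    obtain ⟨x, hx, hx2, -⟩ := IsRegularLocalRing.exists_mem_notMem_minimalPrimes hn
    obtain ⟨_, hn'⟩ := exists_isRegularLocalRing_quotient hn hx hx2
    have := IsRegularLocalRing.isDomain T
    refine isPowFlat_of_quotient (x := x) ?_ hx h
      (ih _ hn' (h.of_surjective _ Ideal.Quotient.mk_surjective))
    rintro rfl
    exact hx2 (zero_mem _)

theorem isPowFlat_of_isRegularLocalRing (T : Type u) [CommRing T] [IsRegularLocalRing T]
    (h : IsPowAdditive T q) : IsPowFlat T q :=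
  isPowFlat_of_spanFinrank q _ T rfl h

end FrobeniusFlat

/-! ### Globalization, and Frobenius powers of colons and intersections. -/

section RegularRing

open IsLocalRing

theorem isPowAdditive_of_cast_eq_zero {A : Type u} [CommRing A] (p : ℕ) [hp : Fact p.Prime]
    (h : (p : A) = 0) (e : ℕ) : IsPowAdditive A (p ^ e) := by
  refine ⟨pow_ne_zero e hp.out.ne_zero, fun x y => ?_⟩
  rcases subsingleton_or_nontrivial A with _ | _
  · exact Subsingleton.elim _ _
  · have := (CharP.charP_iff_prime_eq_zero (R := A) hp.out).2 h
    exact add_pow_char_pow x y p e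

theorem isPowFlat_of_localization {A : Type u} [CommRing A] {q : ℕ}
    (h : ∀ (m : Ideal A) [m.IsMaximal], IsPowFlat (Localization.AtPrime m) q) :
    IsPowFlat A q := by
  intro n a c hc
  by_contra hcN
  set N := powRel q a ⊥ with hN
  obtain ⟨m, hm, hle⟩ := Ideal.exists_le_maximal (N.colon {c}) (fun htop => hcN (by
    have : (1 : A) ∈ N.colon {c} := htop ▸ trivial
    simpa [Submodule.mem_colon_singleton] using this))
  set f := algebraMap A (Localization.AtPrime m)
  have h1 := h m n (fun i => f (a i)) (fun i => f (c i)) (by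
    have := congrArg f hc
    simpa [map_sum] using this)
  have h2 : ∀ v ∈ powRel q (fun i => f (a i)) ⊥, ∃ t : m.primeCompl, ∃ w ∈ N,
      ∀ i, f t * v i = f (w i) := by
    intro v hv
    induction hv using Submodule.span_induction with
    | mem v hv =>
      obtain ⟨r, hr, rfl⟩ := hv
      obtain ⟨b, hb⟩ := IsLocalization.exist_integer_multiples_of_finite m.primeCompl r
      choose r' hr' using hb
      have h3 : f (∑ i, a i * r' i) = 0 := by
        have h4 := congrArg (f b * ·) ((Ideal.mem_bot).1 hr)
        simp only [mul_zero, Finset.mul_sum] at h4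
        rw [map_sum, ← h4]
        refine Finset.sum_congr rfl fun i _ => ?_
        rw [map_mul, hr', Algebra.smul_def]; ring
      obtain ⟨u, hu⟩ := (IsLocalization.map_eq_zero_iff m.primeCompl _ _).1 h3
      -- The common denominator is raised to the power q so that clearing it keeps the vector a q-th
      -- power of a relation.
      refine ⟨(u * b) ^ q, (fun i => u * r' i) ^ q, Submodule.subset_span ⟨_, ?_, rfl⟩, fun i => ?_⟩
      · rw [Ideal.mem_bot, ← hu, Finset.mul_sum]
        exact Finset.sum_congr rfl fun i _ => by ring
      · simp only [Pi.pow_apply, SubmonoidClass.coe_pow, Submonoid.coe_mul, map_pow, map_mul]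
        rw [hr', Algebra.smul_def]; ring
    | zero => exact ⟨1, 0, zero_mem _, by simp⟩
    | add v w _ _ hv hw =>
      obtain ⟨t, m, hm, h⟩ := hv
      obtain ⟨t', m', hm', h'⟩ := hw
      refine ⟨t * t', (t' : A) • m + (t : A) • m',
        add_mem (Submodule.smul_mem _ _ hm) (Submodule.smul_mem _ _ hm'), fun i => ?_⟩
      simp only [Pi.add_apply, Pi.smul_apply, smul_eq_mul, map_add, map_mul, Submonoid.coe_mul,
        ← h, ← h']
      ring
    | smul l v _ hv =>
      obtain ⟨t, w, hw, h⟩ := hv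
      obtain ⟨⟨x, s⟩, hx⟩ := IsLocalization.surj m.primeCompl l
      refine ⟨s * t, x • w, Submodule.smul_mem _ _ hw, fun i => ?_⟩
      simp only [Pi.smul_apply, smul_eq_mul, map_mul, Submonoid.coe_mul, ← h, ← hx, f]
      ring
  obtain ⟨t, w, hw, h3⟩ := h2 _ h1
  have h4 : ∀ i, ∃ u : m.primeCompl, (u : A) * (t * c i) = u * w i := fun i =>
    (IsLocalization.eq_iff_exists m.primeCompl (Localization.AtPrime m)).1
      (by rw [map_mul]; exact h3 i)
  choose u hu using h4
  have h5 : ((∏ i, u i : m.primeCompl) * t : m.primeCompl).1 ∈ N.colon {c} := by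
    rw [Submodule.mem_colon_singleton]
    have : ((∏ i, u i : m.primeCompl) * t : m.primeCompl).1 • c =
        (∏ i, u i : m.primeCompl).1 • w := by
      ext i
      obtain ⟨z, hz⟩ := Finset.dvd_prod_of_mem u (Finset.mem_univ i)
      simp only [Pi.smul_apply, smul_eq_mul, hz, Submonoid.coe_mul]
      linear_combination (z : A) * hu i
    rw [this]
    exact Submodule.smul_mem _ _ hw
  exact ((∏ i, u i : m.primeCompl) * t).2 (hle h5)

theorem isPowFlat_of_isRegularRing (T : Type u) [CommRing T] [IsRegularRing T] (p : ℕ)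
    [Fact p.Prime] [CharP T p] (e : ℕ) : IsPowFlat T (p ^ e) :=
  isPowFlat_of_localization fun m _ =>
    isPowFlat_of_isRegularLocalRing _ (isPowAdditive_of_cast_eq_zero p (by
      rw [← map_natCast (algebraMap T _), CharP.cast_eq_zero, map_zero]) e)

variable {A : Type u} [CommRing A] {p e : ℕ}

/-- The membership is a relation between the q-th powers of y and of elements of I. By flatness it
is generated by q-th powers of relations, whose y-coordinates lie in I : y. -/
theorem mem_frobPower_of_colon (h : IsPowFlat A (p ^ e)) {I J : Ideal A} {b y : A}
    (hJ : ∀ z, y * z ∈ I → z ∈ J) (hb : y ^ p ^ e * b ∈ frobPower p e I) :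
    b ∈ frobPower p e J := by
  obtain ⟨k, f, g, hfg⟩ := Submodule.mem_span_set'.1 hb
  choose x hx hxg using fun i => (g i).2
  have h1 := h (k + 1) (Fin.cons y x) (Fin.cons b (-f)) (by
    rw [Fin.sum_univ_succ]
    simp only [Fin.cons_zero, Fin.cons_succ, Pi.neg_apply, mul_neg, Finset.sum_neg_distrib]
    rw [← hfg, ← sub_eq_add_neg, sub_eq_zero]
    exact Finset.sum_congr rfl fun i _ => by rw [← hxg, smul_eq_mul, mul_comm])
  have h2 : ∀ v ∈ powRel (p ^ e) (Fin.cons y x : Fin (k + 1) → A) ⊥, v 0 ∈ frobPower p e J := by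
    intro v hv
    induction hv using Submodule.span_induction with
    | mem v hv =>
      obtain ⟨r, hr, rfl⟩ := hv
      refine Ideal.subset_span ⟨r 0, hJ _ ?_, rfl⟩
      rw [Fin.sum_univ_succ, Ideal.mem_bot] at hr
      simp only [Fin.cons_zero, Fin.cons_succ] at hr
      rw [eq_neg_of_add_eq_zero_left hr]
      exact neg_mem (Ideal.sum_mem _ fun i _ => Ideal.mul_mem_right _ _ (hx i))
    | zero => exact zero_mem _
    | add v w _ _ hv hw => exact add_mem hv hw
    | smul t v _ hv => exact Ideal.mul_mem_left _ _ hv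
  exact h2 _ h1

/-- Two expressions of b form a relation between q-th powers; for each generating relation the first
half sums to an element of I that is also, up to sign, the second half, hence in J. -/
theorem inf_frobPower_le (h : IsPowFlat A (p ^ e)) (hadd : IsPowAdditive A (p ^ e))
    (I J : Ideal A) : frobPower p e I ⊓ frobPower p e J ≤ frobPower p e (I ⊓ J) := by
  rintro b ⟨hI, hJ⟩
  obtain ⟨k, f, g, hfg⟩ := Submodule.mem_span_set'.1 hI
  obtain ⟨l, f', g', hfg'⟩ := Submodule.mem_span_set'.1 hJ
  choose x hx hxg using fun i => (g i).2
  choose x' hx' hxg' using fun i => (g' i).2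
  have h1 := h (k + l) (Fin.append x x') (Fin.append f (-f')) (by
    rw [Fin.sum_univ_add]
    simp only [Fin.append_left, Fin.append_right, Pi.neg_apply, mul_neg, Finset.sum_neg_distrib]
    rw [← sub_eq_add_neg, sub_eq_zero]
    trans b
    · rw [← hfg]
      exact Finset.sum_congr rfl fun i _ => by rw [← hxg, smul_eq_mul, mul_comm]
    · rw [← hfg']
      exact Finset.sum_congr rfl fun i _ => by rw [← hxg', smul_eq_mul, mul_comm])
  have h2 : ∀ v ∈ powRel (p ^ e) (Fin.append x x') ⊥,
      ∑ i, v (Fin.castAdd l i) * x i ^ p ^ e ∈ frobPower p e (I ⊓ J) := by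
    intro v hv
    induction hv using Submodule.span_induction with
    | mem v hv =>
      obtain ⟨r, hr, rfl⟩ := hv
      simp only [Pi.pow_apply, ← mul_pow]
      rw [← hadd.sum_pow]
      refine Ideal.subset_span ⟨_, ⟨?_, ?_⟩, rfl⟩
      · exact Ideal.sum_mem _ fun i _ => Ideal.mul_mem_left _ _ (hx i)
      · rw [Fin.sum_univ_add, Ideal.mem_bot] at hr
        simp only [Fin.append_left, Fin.append_right] at hr
        simp_rw [mul_comm _ (x _)]
        rw [eq_neg_of_add_eq_zero_left hr]
        exact neg_mem (Ideal.sum_mem _ fun i _ => Ideal.mul_mem_right _ _ (hx' i))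
    | zero => simp
    | add v w _ _ hv hw => simpa [add_mul, Finset.sum_add_distrib] using add_mem hv hw
    | smul t v _ hv => simpa [Finset.mul_sum, mul_assoc] using Ideal.mul_mem_left _ t hv
  have := h2 _ h1
  simp only [Fin.append_left] at this
  rw [← hfg]
  refine (congrArg (· ∈ frobPower p e (I ⊓ J)) (Finset.sum_congr rfl fun i _ => ?_)).mp this
  rw [← hxg, smul_eq_mul]

end RegularRing

/-! ### Frobenius powers and membership in extended ideals of the perfect closure. -/

section FrobeniusPower

theorem pow_mem_frobPower {A : Type u} [CommRing A] (p : ℕ) {I : Ideal A} {x : A} (hx : x ∈ I)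
    (n : ℕ) : x ^ p ^ n ∈ frobPower p n I :=
  Ideal.subset_span ⟨x, hx, rfl⟩

theorem frobPower_le {A : Type u} [CommRing A] (p : ℕ) [hp : Fact p.Prime] (n : ℕ) (I : Ideal A) :
    frobPower p n I ≤ I :=
  Ideal.span_le.2 (by
    rintro _ ⟨x, hx, rfl⟩
    exact Ideal.pow_mem_of_mem _ hx _ (pow_pos hp.out.pos n))

variable {A : Type u} [CommRing A] (p : ℕ) [Fact p.Prime] [CharP A p]

theorem frobPower_eq_map (n : ℕ) (I : Ideal A) : frobPower p n I = I.map (iterateFrobenius A p n) :=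
  rfl

theorem frobPower_frobPower (m n : ℕ) (I : Ideal A) :
    frobPower p m (frobPower p n I) = frobPower p (n + m) I := by
  rw [frobPower_eq_map, frobPower_eq_map, frobPower_eq_map, Ideal.map_map, add_comm]
  congr 1
  ext x
  simp only [RingHom.comp_apply, iterateFrobenius_def, ← pow_mul, ← pow_add]
  rw [add_comm]

theorem frobPower_zero (I : Ideal A) : frobPower p 0 I = I := by
  rw [frobPower_eq_map, iterateFrobenius_zero, Ideal.map_id]

theorem pow_mem_frobPower' {I : Ideal A} {n : ℕ} {x : A} (hx : x ∈ frobPower p n I) (m : ℕ) :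
    x ^ p ^ m ∈ frobPower p (n + m) I := by
  rw [← frobPower_frobPower]; exact pow_mem_frobPower p hx m

theorem frobPower_map {B : Type v} [CommRing B] [CharP B p] (f : A →+* B) (n : ℕ) (I : Ideal A) :
    frobPower p n (I.map f) = (frobPower p n I).map f := by
  rw [frobPower_eq_map, frobPower_eq_map, Ideal.map_map, Ideal.map_map]
  congr 1
  ext x
  simp [iterateFrobenius_def]

theorem mem_frobClosure_frobPower {I : Ideal A} {n : ℕ} {r : A} :
    r ∈ frobClosure p (frobPower p n I) ↔ ∃ m, r ^ p ^ m ∈ frobPower p (n + m) I := by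
  simp_rw [← frobPower_frobPower]; rfl

theorem rootHom_pow (n m : ℕ) (r : A) : rootHom p (n + m) (r ^ p ^ m) = rootHom p n r := by
  rw [rootHom_apply, rootHom_apply, PerfectClosure.mk_eq_iff]
  refine ⟨0, ?_⟩
  simp only [← coe_iterateFrobenius, iterateFrobenius_def, ← pow_mul, ← pow_add, add_zero]
  rw [add_comm]

theorem rootHom_pow_self (m : ℕ) (r : A) : rootHom p m (r ^ p ^ m) = rootHom p 0 r := by
  simpa using rootHom_pow p 0 m r

theorem rootHom_zero : rootHom p 0 = PerfectClosure.of A p := by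
  ext r; rw [rootHom_apply]; rfl

theorem rootHom_surjective (x : PerfectClosure A p) : ∃ n r, rootHom p n r = x := by
  obtain ⟨⟨n, r⟩, rfl⟩ := PerfectClosure.mk_surjective A p x
  exact ⟨n, r, rootHom_apply p n r⟩

theorem rootHom_pow_pow (n : ℕ) (r : A) : rootHom p n r ^ p ^ n = rootHom p 0 r := by
  rw [← map_pow, rootHom_pow_self]

theorem rootHom_eq_iff {n m : ℕ} {r s : A} (h : rootHom p n r = rootHom p m s) :
    ∃ t, r ^ p ^ (m + t) = s ^ p ^ (n + t) := by
  rw [rootHom_apply, rootHom_apply, PerfectClosure.mk_eq_iff] at h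
  obtain ⟨t, h⟩ := h
  refine ⟨t, ?_⟩
  simpa only [← coe_iterateFrobenius, iterateFrobenius_def] using h

/-- Every element of the extended ideal is ψ_k(z) with z ∈ I^[p^k] for some k. Two representatives
of one element agree only after a power of Frobenius, which is what the F-closure absorbs. -/
theorem rootHom_mem_map_of {I : Ideal A} {n : ℕ} {r : A} :
    rootHom p n r ∈ I.map (PerfectClosure.of A p) ↔ r ∈ frobClosure p (frobPower p n I) := by
  rw [mem_frobClosure_frobPower]
  constructor
  · intro h
    have key : ∀ y ∈ I.map (PerfectClosure.of A p), ∃ k, ∃ z ∈ frobPower p k I,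
        y = rootHom p k z := by
      intro y hy
      induction hy using Submodule.span_induction with
      | mem y hy =>
        obtain ⟨x, hx, rfl⟩ := hy
        exact ⟨0, x, by rwa [frobPower_zero], by rw [rootHom_zero]⟩
      | zero => exact ⟨0, 0, zero_mem _, by simp⟩
      | add y w _ _ hy hw =>
        obtain ⟨k, z, hz, rfl⟩ := hy
        obtain ⟨l, w, hw, rfl⟩ := hw
        refine ⟨k + l, z ^ p ^ l + w ^ p ^ k, add_mem (pow_mem_frobPower' p hz l) ?_, ?_⟩
        · rw [add_comm]; exact pow_mem_frobPower' p hw k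
        · rw [map_add, rootHom_pow, add_comm k l, rootHom_pow]
      | smul s y _ hy =>
        obtain ⟨k, z, hz, rfl⟩ := hy
        obtain ⟨j, s, rfl⟩ := rootHom_surjective p s
        refine ⟨k + j, s ^ p ^ k * z ^ p ^ j,
          Ideal.mul_mem_left _ _ (pow_mem_frobPower' p hz j), ?_⟩
        rw [map_mul, rootHom_pow, add_comm k j, rootHom_pow, smul_eq_mul]
    obtain ⟨k, z, hz, h⟩ := key _ h
    obtain ⟨t, ht⟩ := rootHom_eq_iff p h
    refine ⟨k + t, ?_⟩
    rw [ht, show n + (k + t) = k + (n + t) by ring]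
    exact pow_mem_frobPower' p hz _
  · rintro ⟨m, h⟩
    have key : ∀ k, frobPower p k I ≤ (I.map (PerfectClosure.of A p)).comap (rootHom p k) := by
      intro k
      refine Ideal.span_le.2 ?_
      rintro _ ⟨x, hx, rfl⟩
      simp only [Ideal.coe_comap, Set.mem_preimage, SetLike.mem_coe]
      rw [rootHom_pow_self, rootHom_zero]
      exact Ideal.mem_map_of_mem _ hx
    rw [← rootHom_pow p n m]
    exact key _ h

end FrobeniusPower

/-! ### Contraction and transport of primary decompositions. -/

section PrimaryDecomposition

theorem Ideal.IsPrimary.comap_of_isPrimary {A : Type u} {B : Type v} [CommRing A] [CommRing B]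
    (f : A →+* B) {q : Ideal B} (hq : q.IsPrimary) : (q.comap f).IsPrimary := by
  rw [Ideal.isPrimary_iff] at hq ⊢
  refine ⟨fun h => hq.1 ((Ideal.comap_eq_top_iff).1 h), fun {x y} hxy => ?_⟩
  rw [← Ideal.comap_radical]
  exact hq.2 (by simpa using hxy)

theorem Ideal.comap_finset_inf {A : Type u} {B : Type v} [CommRing A] [CommRing B]
    (f : A →+* B) [DecidableEq (Ideal A)] (s : Finset (Ideal B)) :
    (s.image (Ideal.comap f)).inf id = (s.inf id).comap f := by
  ext x
  simp [Ideal.mem_comap, Submodule.mem_finsetInf]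

theorem HasPrimaryDecomposition.comap {A : Type u} {B : Type v} [CommRing A] [CommRing B]
    (f : A →+* B) {I : Ideal B} (hI : HasPrimaryDecomposition I) :
    HasPrimaryDecomposition (I.comap f) := by
  classical
  obtain ⟨s, hs, rfl⟩ := hI
  refine ⟨s.image (Ideal.comap f), fun q hq => ?_, Ideal.comap_finset_inf f s⟩
  obtain ⟨q, hq', rfl⟩ := Finset.mem_image.1 hq
  exact (hs q hq').comap_of_isPrimary f

theorem Ideal.mem_map_ringEquiv {A : Type u} {B : Type v} [CommRing A] [CommRing B]
    (e : A ≃+* B) {I : Ideal A} {x : A} : e x ∈ I.map (e : A →+* B) ↔ x ∈ I := by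
  have : I.map (e : A →+* B) = I.comap (e.symm : B →+* A) := Ideal.map_comap_of_equiv e
  rw [this, Ideal.mem_comap]
  simp

theorem HasPrimaryDecomposition.map_ringEquiv {A : Type u} {B : Type v} [CommRing A] [CommRing B]
    (e : A ≃+* B) {I : Ideal A} (hI : HasPrimaryDecomposition I) :
    HasPrimaryDecomposition (I.map (e : A →+* B)) := by
  have : I.map (e : A →+* B) = I.comap (e.symm : B →+* A) := Ideal.map_comap_of_equiv e
  rw [this]
  exact hI.comap _

end PrimaryDecomposition

/-! ### Ideals of a pure subring are contracted. -/

section Contraction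

theorem IsPureSubring.injective {A : Type u} {B : Type v} [CommRing A] [CommRing B] [Algebra A B]
    (h : IsPureSubring A B) : Function.Injective (algebraMap A B) := by
  intro x y hxy
  have h1 := @h A _ _ ((1 : A) ⊗ₜ[A] x) ((1 : A) ⊗ₜ[A] y) (by
    rw [LinearMap.lTensor_tmul, LinearMap.lTensor_tmul, Algebra.linearMap_apply,
      Algebra.linearMap_apply, hxy])
  simpa using congrArg (TensorProduct.lid A A) h1

/-- Purity is tested on the module A/I: elements of IB die in A/I ⊗ B. -/
theorem IsPureSubring.comap_map_le {A : Type u} {B : Type v} [CommRing A] [CommRing B] [Algebra A B]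
    (h : IsPureSubring A B) (I : Ideal A) :
    (I.map (algebraMap A B)).comap (algebraMap A B) ≤ I := by
  intro x hx
  have key : ∀ y ∈ I.map (algebraMap A B), (1 : A ⧸ I) ⊗ₜ[A] y = 0 := by
    intro y hy
    induction hy using Submodule.span_induction with
    | mem y hy =>
      obtain ⟨z, hz, rfl⟩ := hy
      rw [Algebra.algebraMap_eq_smul_one, ← TensorProduct.smul_tmul, Algebra.smul_def, mul_one,
        Ideal.Quotient.algebraMap_eq, Ideal.Quotient.eq_zero_iff_mem.2 hz, TensorProduct.zero_tmul]
    | zero => exact TensorProduct.tmul_zero _ _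
    | add y w _ _ hy hw => rw [TensorProduct.tmul_add, hy, hw, add_zero]
    | smul t y _ hy =>
      have := congrArg (LinearMap.lTensor (A ⧸ I) (LinearMap.mulLeft A t)) hy
      simpa using this
  have h1 := @h (A ⧸ I) _ _ ((1 : A ⧸ I) ⊗ₜ[A] x) 0 (by
    rw [LinearMap.lTensor_tmul, map_zero]
    exact key _ hx)
  have h2 := congrArg (TensorProduct.rid A (A ⧸ I)) h1
  rw [TensorProduct.rid_tmul, map_zero, Algebra.smul_def, mul_one,
    Ideal.Quotient.algebraMap_eq] at h2
  exact Ideal.Quotient.eq_zero_iff_mem.1 h2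

end Contraction

/-! ### Primary decompositions in the perfect closure. -/

section PerfectClosure

theorem IsPurelyInsepExtension.isPRadical {A : Type u} {B : Type v} [CommRing A] [CommRing B]
    {p : ℕ} {i : A →+* B} (h : IsPurelyInsepExtension p i) : IsPRadical i p where
  pow_mem' x := by
    obtain ⟨n, y, hy⟩ := h.2 x
    exact ⟨n, y, hy⟩
  ker_le' := by
    rw [(RingHom.injective_iff_ker_eq_bot i).1 h.1]
    exact bot_le

variable {A : Type u} [CommRing A] (p : ℕ) [Fact p.Prime] [CharP A p]

theorem hasPrimaryDecomposition_map_of [IsNoetherianRing A] (h : ∀ e, IsPowFlat A (p ^ e))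
    (I : Ideal A) : HasPrimaryDecomposition (I.map (PerfectClosure.of A p)) := by
  classical
  have hinf : ∀ I J : Ideal A, (I ⊓ J).map (PerfectClosure.of A p) =
      I.map (PerfectClosure.of A p) ⊓ J.map (PerfectClosure.of A p) := by
    intro I J
    refine le_antisymm (Ideal.map_inf_le _) ?_
    rintro x ⟨hI, hJ⟩
    obtain ⟨n, r, rfl⟩ := rootHom_surjective p x
    simp only [SetLike.mem_coe, rootHom_mem_map_of, mem_frobClosure_frobPower] at hI hJ ⊢
    obtain ⟨m, hI⟩ := hI
    obtain ⟨l, hJ⟩ := hJ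
    refine ⟨m + l, inf_frobPower_le (h _)
      (isPowAdditive_of_cast_eq_zero p (CharP.cast_eq_zero A p) _) _ _ ⟨?_, ?_⟩⟩
    · rw [pow_add, pow_mul, ← add_assoc]; exact pow_mem_frobPower' p hI l
    · rw [add_comm m, pow_add, pow_mul, ← add_assoc]; exact pow_mem_frobPower' p hJ m
  have hprim : ∀ q : Ideal A, q.IsPrimary → (q.map (PerfectClosure.of A p)).IsPrimary := by
    intro q hq
    rw [Ideal.isPrimary_iff] at hq ⊢
    refine ⟨fun htop => hq.1 ?_, fun {x y} hxy => ?_⟩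
    · have : rootHom p 0 (1 : A) ∈ q.map (PerfectClosure.of A p) := htop ▸ trivial
      rw [rootHom_mem_map_of, mem_frobClosure_frobPower] at this
      obtain ⟨m, hm⟩ := this
      rw [one_pow] at hm
      exact (Ideal.eq_top_iff_one _).2 (frobPower_le p _ _ hm)
    · obtain ⟨n, r, rfl⟩ := rootHom_surjective p x
      obtain ⟨l, s, rfl⟩ := rootHom_surjective p y
      by_cases hs : s ∈ q.radical
      · right
        obtain ⟨k, hk⟩ := hs
        refine ⟨p ^ l * k, ?_⟩
        rw [pow_mul, rootHom_pow_pow, ← map_pow, rootHom_zero]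
        exact Ideal.mem_map_of_mem _ hk
      · left
        have e : rootHom p n r * rootHom p l s = rootHom p (n + l) (r ^ p ^ l * s ^ p ^ n) := by
          rw [map_mul, rootHom_pow, add_comm n l, rootHom_pow]
        rw [e, rootHom_mem_map_of, mem_frobClosure_frobPower] at hxy
        obtain ⟨m, hm⟩ := hxy
        rw [rootHom_mem_map_of, mem_frobClosure_frobPower]
        refine ⟨l + m, ?_⟩
        rw [← add_assoc]
        refine mem_frobPower_of_colon (h _) (y := s) (I := q)
          (fun z hz => (hq.2 (mul_comm s z ▸ hz)).resolve_right hs) ?_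
        -- The colon lemma needs the exponent of s to match the Frobenius power n + l + m; the
        -- hypothesis has the smaller exponent p^(n + m), so s is multiplied up.
        have h1 : s ^ p ^ (n + l + m) * r ^ p ^ (l + m) =
            s ^ (p ^ (n + l + m) - p ^ (n + m)) * (r ^ p ^ l * s ^ p ^ n) ^ p ^ m := by
          have h2 : p ^ (n + l + m) = (p ^ (n + l + m) - p ^ (n + m)) + p ^ (n + m) :=
            (Nat.sub_add_cancel (Nat.pow_le_pow_right (Fact.out : p.Prime).pos (by omega))).symm
          conv_lhs => rw [h2, pow_add]
          rw [mul_pow, ← pow_mul, ← pow_mul, ← pow_add, ← pow_add]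
          ring
        rw [h1]
        exact Ideal.mul_mem_left _ _ hm
  obtain ⟨s, hs, hsp⟩ := Submodule.isLasker A A I
  refine ⟨s.image (Ideal.map (PerfectClosure.of A p)), fun q hq => ?_, ?_⟩
  · obtain ⟨q, hq', rfl⟩ := Finset.mem_image.1 hq
    exact hprim q (hsp hq')
  · rw [← hs]
    clear hs hsp
    induction s using Finset.induction_on with
    | empty => simp [Ideal.map_top]
    | insert q s _ ih => rw [Finset.image_insert, Finset.inf_insert, Finset.inf_insert, ih, id, id,
        hinf]

theorem rootHom_eq_comp (n : ℕ) : rootHom p n =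
    ((iterateFrobeniusEquiv (PerfectClosure A p) p n).symm : _ →+* _).comp
      (PerfectClosure.of A p) :=
  rfl

theorem hasPrimaryDecomposition_map_rootHom (I : Ideal A)
    (h : HasPrimaryDecomposition (I.map (PerfectClosure.of A p))) (n : ℕ) :
    HasPrimaryDecomposition (I.map (rootHom p n)) := by
  rw [rootHom_eq_comp, ← Ideal.map_map]
  exact h.map_ringEquiv _

theorem rootHom_mem_map_rootHom {I : Ideal A} {k n : ℕ} {r : A} :
    rootHom p (k + n) r ∈ I.map (rootHom p n) ↔ r ∈ frobClosure p (frobPower p k I) := by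
  have h : rootHom p (k + n) r =
      (iterateFrobeniusEquiv (PerfectClosure A p) p n).symm (rootHom p k r) := by
    rw [RingEquiv.eq_symm_apply, iterateFrobeniusEquiv_apply, iterateFrobenius_def, ← map_pow,
      rootHom_pow]
  rw [h, rootHom_eq_comp p n, ← Ideal.map_map, Ideal.mem_map_ringEquiv, rootHom_mem_map_of]

/-- Finitely many generators have roots of bounded order, so all come from one level ψ_n. -/
theorem Ideal.FG.exists_eq_map_rootHom {𝔄 : Ideal (PerfectClosure A p)} (h : 𝔄.FG) :
    ∃ n, ∃ I : Ideal A, 𝔄 = I.map (rootHom p n) := by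
  obtain ⟨s, rfl⟩ := h
  choose N f hf using rootHom_surjective (A := A) p
  refine ⟨s.sup N, Ideal.span ((fun x => f x ^ p ^ (s.sup N - N x)) '' s), ?_⟩
  rw [Ideal.map_span, Set.image_image]
  congr 1
  refine (Set.image_id _).symm.trans (Set.image_congr fun x hx => ?_)
  have h1 := rootHom_pow p (N x) (s.sup N - N x) (f x)
  rw [Nat.add_sub_cancel' (Finset.le_sup hx), hf] at h1
  exact h1.symm

theorem hasPrimaryDecomposition_of_comap_map_le {T : Type v} [CommRing T] [CharP T p] (j : A →+* T)
    (hj : ∀ I : Ideal A, (I.map j).comap j ≤ I)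
    (hT : ∀ I : Ideal T, HasPrimaryDecomposition (I.map (PerfectClosure.of T p)))
    {𝔄 : Ideal (PerfectClosure A p)} (h𝔄 : 𝔄.FG) : HasPrimaryDecomposition 𝔄 := by
  obtain ⟨n, I, rfl⟩ := h𝔄.exists_eq_map_rootHom
  let φ : PerfectClosure A p →+* PerfectClosure T p :=
    PerfectClosure.lift A p (PerfectClosure T p) ((PerfectClosure.of T p).comp j)
  have hφ : ∀ k r, φ (rootHom p k r) = rootHom p k (j r) := by
    intro k r
    refine (iterateFrobeniusEquiv (PerfectClosure T p) p k).injective ?_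
    simp only [iterateFrobeniusEquiv_apply, iterateFrobenius_def]
    rw [← map_pow, rootHom_pow_pow, rootHom_pow_pow, rootHom_zero, rootHom_zero]
    exact congrArg (fun g : A →+* PerfectClosure T p => g r)
      ((PerfectClosure.lift A p (PerfectClosure T p)).symm_apply_apply
        ((PerfectClosure.of T p).comp j))
  have hcomp : φ.comp (rootHom p n) = (rootHom p n).comp j := RingHom.ext fun r => hφ n r
  have hle : ((I.map (rootHom p n)).map φ).comap φ = I.map (rootHom p n) := by
    refine le_antisymm (fun x hx => ?_) Ideal.le_comap_map
    obtain ⟨k, r, rfl⟩ := rootHom_surjective p x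
    -- Moving to level k + n puts the element above the level n where the ideal lives, so that
    -- `rootHom_mem_map_rootHom` applies.
    rw [← rootHom_pow p k n] at hx ⊢
    rw [Ideal.mem_comap, hφ, Ideal.map_map, hcomp, ← Ideal.map_map, rootHom_mem_map_rootHom,
      mem_frobClosure_frobPower] at hx
    rw [rootHom_mem_map_rootHom, mem_frobClosure_frobPower]
    obtain ⟨m, hm⟩ := hx
    refine ⟨m, hj _ ?_⟩
    rwa [Ideal.mem_comap, map_pow, ← frobPower_map]
  rw [← hle, Ideal.map_map, hcomp, ← Ideal.map_map]
  exact (hasPrimaryDecomposition_map_rootHom p _ (hT _) n).comap φ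

/-- The composite A → B → B^∞ is p-radical with perfect target, so B^∞ is a perfect closure of A
too. -/
theorem IsPurelyInsepExtension.nonempty_ringEquiv {B : Type v} [CommRing B] [CharP B p]
    {i : A →+* B}
    (h : IsPurelyInsepExtension p i) : Nonempty (PerfectClosure A p ≃+* PerfectClosure B p) := by
  have := h.isPRadical
  have : IsPRadical ((PerfectClosure.of B p).comp i) p := IsPRadical.trans i _ p
  exact ⟨IsPerfectClosure.equiv (PerfectClosure.of A p) ((PerfectClosure.of B p).comp i) p⟩

theorem hasPrimaryDecomposition_of_fg {B : Type*} [CommRing B] [CharP B p]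
    {T : Type*} [CommRing T] [IsRegularRing T] [CharP T p] [Algebra B T]
    (hpure : IsPureSubring B T)
    (hinsep : (∃ i : B →+* A, IsPurelyInsepExtension p i) ∨
      (∃ i : A →+* B, IsPurelyInsepExtension p i))
    {𝔄 : Ideal (PerfectClosure A p)} (h𝔄 : 𝔄.FG) : HasPrimaryDecomposition 𝔄 := by
  obtain ⟨e⟩ : Nonempty (PerfectClosure A p ≃+* PerfectClosure B p) := by
    rcases hinsep with ⟨i, hi⟩ | ⟨i, hi⟩
    · exact hi.nonempty_ringEquiv.map RingEquiv.symm
    · exact hi.nonempty_ringEquiv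
  have h1 : HasPrimaryDecomposition (𝔄.map (e : PerfectClosure A p →+* PerfectClosure B p)) :=
    hasPrimaryDecomposition_of_comap_map_le p (algebraMap B T) hpure.comap_map_le
      (hasPrimaryDecomposition_map_of p fun e => isPowFlat_of_isRegularRing T p e) (h𝔄.map _)
  have h2 := h1.comap (e : PerfectClosure A p →+* PerfectClosure B p)
  rwa [Ideal.comap_map_of_bijective (e : PerfectClosure A p →+* PerfectClosure B p)
    e.bijective] at h2

end PerfectClosure

/-! ### From an ideal of the perfect closure to its f-sequence. -/

section Correspondence

variable {R : Type u} [CommRing R] (p : ℕ) [Fact p.Prime] [CharP R p]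

/-- Since ψ_n(r)^(p^n) = ψ_0(r), a radical ideal cannot tell the maps ψ_n apart. -/
theorem Ideal.IsRadical.comap_rootHom {P : Ideal (PerfectClosure R p)} (hP : P.IsRadical) (n : ℕ) :
    P.comap (rootHom p n) = P.comap (rootHom p 0) := by
  ext r
  rw [Ideal.mem_comap, Ideal.mem_comap, ← rootHom_pow_pow p n r]
  exact ⟨fun h => Ideal.pow_mem_of_mem _ h _ (pow_pos (Fact.out : p.Prime).pos n),
    fun h => hP ⟨_, h⟩⟩

theorem Ideal.IsRadical.eq_of_comap_rootHom {P Q : Ideal (PerfectClosure R p)} (hP : P.IsRadical)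
    (hQ : Q.IsRadical) (h : P.comap (rootHom p 0) = Q.comap (rootHom p 0)) : P = Q := by
  ext x
  obtain ⟨n, r, rfl⟩ := rootHom_surjective p x
  rw [← Ideal.mem_comap, hP.comap_rootHom, h, ← hQ.comap_rootHom p n, Ideal.mem_comap]

theorem Ideal.IsRadical.isPrime_of_comap_rootHom {P : Ideal (PerfectClosure R p)}
    (hP : P.IsRadical) (h : (P.comap (rootHom p 0)).IsPrime) : P.IsPrime := by
  refine ⟨fun htop => h.ne_top (by rw [htop, Ideal.comap_top]), fun {x y} hxy => ?_⟩
  obtain ⟨n, r, rfl⟩ := rootHom_surjective p x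
  obtain ⟨m, s, rfl⟩ := rootHom_surjective p y
  rw [← Ideal.mem_comap, ← Ideal.mem_comap, hP.comap_rootHom p n, hP.comap_rootHom p m]
  refine h.mem_or_mem ?_
  have := P.mul_mem_left (rootHom p n r ^ (p ^ n - 1) * rootHom p m s ^ (p ^ m - 1)) hxy
  rw [Ideal.mem_comap, map_mul, ← rootHom_pow_pow p n r, ← rootHom_pow_pow p m s]
  have e : ∀ k, p ^ k = p ^ k - 1 + 1 := fun k =>
    (Nat.sub_add_cancel (pow_pos (Fact.out : p.Prime).pos k)).symm
  rw [e n, e m, pow_succ, pow_succ]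
  convert this using 1
  ring

variable {p} in
theorem CorrespondsTo.isFSequence {𝔄 : Ideal (PerfectClosure R p)} {I : ℕ → Ideal R}
    (h : CorrespondsTo p 𝔄 I) : IsFSequence p I := by
  intro n
  rw [← h (n + 1), ← h n, Ideal.comap_comap]
  congr 1
  ext r
  have := rootHom_pow p n 1 r
  rwa [pow_one] at this

theorem hasLinearGrowth_of_correspondsTo [IsNoetherianRing R] {𝔄 : Ideal (PerfectClosure R p)}
    {I : ℕ → Ideal R} (h : CorrespondsTo p 𝔄 I) (hA : HasPrimaryDecomposition 𝔄)
    (hI : ∀ n, I n ≠ ⊤) : HasLinearGrowth p I := by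
  classical
  refine ⟨h.isFSequence, hI, ?_⟩
  obtain ⟨s, hs, hinf⟩ := hA
  obtain ⟨t, htinf, htp, htr⟩ :=
    Submodule.isPrimary_decomposition_pairwise_ne_radical hinf (fun J hJ => hs J hJ)
  simp only [Submodule.colon_univ] at htr
  choose N hN using fun q : Ideal R =>
    q.exists_radical_pow_le_of_fg q.radical.fg_of_isNoetherianRing
  -- For each component q, N bounds the power of the radical of ψ_0⁻¹(q) contained in ψ_0⁻¹(q). The
  -- n-th Frobenius maps ψ_0⁻¹(q) into ψ_n⁻¹(q), so the bound serves every n; the summand 1 ensures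
  -- positivity.
  refine ⟨∑ q ∈ t, N (Ideal.comap (rootHom p 0) q) + 1, Nat.succ_pos _, fun n => ?_⟩
  obtain ⟨w, hwt, hwinf, hwmin⟩ := Submodule.decomposition_erase_inf
    ((Ideal.comap_finset_inf (rootHom p n) t).trans ((congrArg _ htinf).trans (h n)))
  refine ⟨w, ⟨hwinf, fun J hJ => ?_, ?_, hwmin⟩, fun q hq => ?_⟩
  · obtain ⟨q, hq, rfl⟩ := Finset.mem_image.1 (hwt hJ)
    exact Ideal.IsPrimary.comap_of_isPrimary _ (htp hq)
  · intro J hJ K hK hJK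
    obtain ⟨q, hq, rfl⟩ := Finset.mem_image.1 (hwt hJ)
    obtain ⟨q', hq', rfl⟩ := Finset.mem_image.1 (hwt hK)
    simp only [Function.onFun, Submodule.colon_univ, ← Ideal.comap_radical]
    intro heq
    rw [(Ideal.radical_isRadical q).comap_rootHom p n,
      (Ideal.radical_isRadical q').comap_rootHom p n] at heq
    refine htr hq hq' (fun h => hJK (by rw [h])) ?_
    exact (Ideal.radical_isRadical _).eq_of_comap_rootHom p (Ideal.radical_isRadical _) heq
  · obtain ⟨q, hqt, rfl⟩ := Finset.mem_image.1 (hwt hq)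
    have h1 : frobPower p n (q.comap (rootHom p n)).radical ≤
        ((q.comap (rootHom p 0)).radical).map (iterateFrobenius R p n) := by
      rw [← Ideal.comap_radical, (Ideal.radical_isRadical _).comap_rootHom, Ideal.comap_radical]
      exact le_rfl
    refine (Ideal.pow_right_mono h1 _).trans ?_
    rw [← Ideal.map_pow, Ideal.map_le_iff_le_comap]
    refine (Ideal.pow_le_pow_right ((Finset.single_le_sum
      (f := fun q => N (Ideal.comap (rootHom p 0) q))
      (fun _ _ => Nat.zero_le _) hqt).trans (Nat.le_succ _))).trans ((hN _).trans fun r hr => ?_)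
    rw [Ideal.mem_comap, Ideal.mem_comap, iterateFrobenius_def, rootHom_pow_self]
    exact hr

theorem associatedPrimes_quotient {A : Type u} [CommRing A] (I : Ideal A) :
    associatedPrimes A (A ⧸ I) = Submodule.associatedPrimes I := by
  have key : ∀ x : A, (⊥ : Submodule A (A ⧸ I)).colon {Ideal.Quotient.mk I x} =
      Submodule.colon I {x} := fun x => by
    ext r
    rw [Submodule.mem_colon_singleton, Submodule.mem_colon_singleton, Submodule.mem_bot,
      Algebra.smul_def, Ideal.Quotient.algebraMap_eq, ← map_mul, Ideal.Quotient.eq_zero_iff_mem]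
    rfl
  ext P
  constructor
  · rintro ⟨hP, x, rfl⟩
    obtain ⟨x, rfl⟩ := Ideal.Quotient.mk_surjective x
    exact ⟨hP, x, by rw [key]⟩
  · rintro ⟨hP, x, rfl⟩
    exact ⟨hP, Ideal.Quotient.mk I x, by rw [key]⟩

/-- The colon I_n : r is ψ_n⁻¹(𝔄 : ψ_n(r)), its radical can be contracted along ψ_0 instead, and
every element of R^∞ is some ψ_n(r). -/
theorem iUnion_associatedPrimes {𝔄 : Ideal (PerfectClosure R p)} {I : ℕ → Ideal R}
    (h : CorrespondsTo p 𝔄 I) : ⋃ n, associatedPrimes R (R ⧸ I n) =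
      Ideal.comap (rootHom p 0) '' Submodule.associatedPrimes 𝔄 := by
  have key : ∀ n r, (Submodule.colon (I n) {r}).radical =
      ((Submodule.colon 𝔄 {rootHom p n r}).radical).comap (rootHom p 0) := by
    intro n r
    rw [← (Ideal.radical_isRadical _).comap_rootHom p n, Ideal.comap_radical]
    congr 1
    ext s
    rw [Submodule.mem_colon_singleton, Ideal.mem_comap, Submodule.mem_colon_singleton, smul_eq_mul,
      smul_eq_mul, ← map_mul, ← Ideal.mem_comap, h n]
  ext P
  simp_rw [Set.mem_iUnion, associatedPrimes_quotient]
  constructor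
  · rintro ⟨n, hP, r, rfl⟩
    rw [key] at hP ⊢
    exact ⟨_, ⟨(Ideal.radical_isRadical _).isPrime_of_comap_rootHom p hP, _, rfl⟩, rfl⟩
  · rintro ⟨_, ⟨hP, x, rfl⟩, rfl⟩
    obtain ⟨n, r, rfl⟩ := rootHom_surjective p x
    refine ⟨n, ?_, r, (key n r).symm⟩
    exact Ideal.comap_isPrime _ _

/-- The radical of I : x is the intersection of the √q with x ∉ q, and a prime that is a finite
intersection equals one of its terms. No Noetherian condition enters, as needed for R^∞. -/
theorem associatedPrimes_subset_image_radical {A : Type u} [CommRing A] {I : Ideal A}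
    {t : Finset (Ideal A)} (hinf : t.inf id = I) (ht : ∀ q ∈ t, q.IsPrimary) :
    Submodule.associatedPrimes I ⊆ Ideal.radical '' (t : Set (Ideal A)) := by
  classical
  rintro P ⟨hP, x, rfl⟩
  have h : Ideal.radical (Submodule.colon I {x}) = (t.filter (x ∉ ·)).inf Ideal.radical := by
    ext y
    rw [← hinf]
    simp only [Ideal.mem_radical_iff, Submodule.mem_colon_singleton, Submodule.mem_finsetInf,
      Finset.mem_filter, id, smul_eq_mul]
    constructor
    · rintro ⟨n, hn⟩ q ⟨hq, hxq⟩
      have := ((Ideal.isPrimary_iff.1 (ht q hq)).2 (mul_comm _ x ▸ hn q hq)).resolve_left hxq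
      exact Ideal.radical_isRadical q ⟨n, this⟩
    · intro h
      choose! N hN using h
      refine ⟨∑ q ∈ t, N q, fun q hq => ?_⟩
      by_cases hxq : x ∈ q
      · exact Ideal.mul_mem_left _ _ hxq
      · refine Ideal.mul_mem_right _ _ (Ideal.pow_mem_of_pow_mem _ (hN q ⟨hq, hxq⟩) ?_)
        exact Finset.single_le_sum (f := N) (fun _ _ => Nat.zero_le _) hq
  rw [h] at hP ⊢
  obtain ⟨q, hq, h1⟩ := Ideal.eq_inf_of_isPrime_inf hP
  exact ⟨q, Finset.mem_of_mem_filter q hq, h1⟩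

theorem HasPrimaryDecomposition.finite_associatedPrimes {A : Type u} [CommRing A] {I : Ideal A}
    (h : HasPrimaryDecomposition I) : (Submodule.associatedPrimes I).Finite := by
  obtain ⟨s, hs, hinf⟩ := h
  exact (s.finite_toSet.image _).subset (associatedPrimes_subset_image_radical hinf hs)

theorem correspondsTo_frobClosure (𝔞 : Ideal R) :
    CorrespondsTo p (𝔞.map (PerfectClosure.of R p)) (fun n => frobClosure p (frobPower p n 𝔞)) :=
  fun _ => Ideal.ext fun _ => rootHom_mem_map_of p

theorem frobClosure_frobPower_ne_top {𝔞 : Ideal R} (h : 𝔞 ≠ ⊤) (n : ℕ) :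
    frobClosure p (frobPower p n 𝔞) ≠ ⊤ := by
  intro htop
  have : (1 : R) ∈ frobClosure p (frobPower p n 𝔞) := htop ▸ trivial
  rw [mem_frobClosure_frobPower] at this
  obtain ⟨m, hm⟩ := this
  rw [one_pow] at hm
  exact h ((Ideal.eq_top_iff_one _).2 (frobPower_le p _ _ hm))

end Correspondence

/-! ### Tight closure seen in the perfect closure. -/

section TightClosure

variable {R : Type u} [CommRing R] (p : ℕ) [Fact p.Prime] [CharP R p]

theorem pow_mem_minCompl {A : Type u} [CommRing A] {c : A} (hc : c ∈ minCompl A) (n : ℕ) :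
    c ^ n ∈ minCompl A := by
  induction n with
  | zero => simpa using one_mem_minCompl
  | succ n ih => rw [pow_succ]; exact mul_mem_minCompl ih hc

theorem frobClosure_le_tightClosure (I : Ideal R) : frobClosure p I ≤ tightClosure p I := by
  rintro r ⟨m, hm⟩
  refine ⟨1, one_mem_minCompl, m, fun n hn => ?_⟩
  obtain ⟨k, rfl⟩ := Nat.exists_eq_add_of_le hn
  rw [one_mul]
  exact pow_mem_frobPower_add hm Fact.out k

/-- F-closure lies in tight closure, so the test element applies to d r^(p^n) at exponent m₀ and
yields the multiplier c d^(p^m₀), with the index shifted by m₀. -/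
theorem mem_tightClosure_of_frobClosure {m₀ : ℕ} {c : R} (hc : IsWeakTestElement p m₀ c)
    {I : Ideal R} {r d : R} (hd : d ∈ minCompl R) (N : ℕ)
    (h : ∀ n ≥ N, d * r ^ p ^ n ∈ frobClosure p (frobPower p n I)) : r ∈ tightClosure p I := by
  refine ⟨c * d ^ p ^ m₀, mul_mem_minCompl hc.1 (pow_mem_minCompl hd _), N + m₀, fun n hn => ?_⟩
  obtain ⟨k, rfl⟩ := Nat.exists_eq_add_of_le hn
  have h1 := (hc.2 _ _).1 (frobClosure_le_tightClosure p _ (h (N + k) (by omega))) m₀ le_rfl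
  rw [frobPower_frobPower, mul_pow, ← pow_mul, ← pow_add, ← mul_assoc] at h1
  rwa [add_right_comm] at h1

/-- The ideal of the perfect closure corresponding to the tight closures of the Frobenius powers of
an ideal whose extension is `𝔄`, for a weak test element `c`. -/
noncomputable def testColon (c : R) (𝔄 : Ideal (PerfectClosure R p)) : Ideal (PerfectClosure R p) :=
  ⨅ n, Submodule.colon 𝔄 {rootHom p n c}

variable {p} in
theorem mem_testColon {c : R} {𝔄 : Ideal (PerfectClosure R p)} {x : PerfectClosure R p} :
    x ∈ testColon p c 𝔄 ↔ ∀ n, x * rootHom p n c ∈ 𝔄 := by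
  simp [testColon, Submodule.mem_iInf, Submodule.mem_colon_singleton]

theorem correspondsTo_tightClosure {m₀ : ℕ} {c : R} (hc : IsWeakTestElement p m₀ c) (𝔞 : Ideal R) :
    CorrespondsTo p (testColon p c (𝔞.map (PerfectClosure.of R p)))
      (fun n => tightClosure p (frobPower p n 𝔞)) := by
  intro k
  ext r
  rw [Ideal.mem_comap, mem_testColon]
  constructor
  · intro h
    refine mem_tightClosure_of_frobClosure p hc hc.1 0 fun n _ => ?_
    rw [frobPower_frobPower, ← rootHom_mem_map_of, map_mul, rootHom_pow, mul_comm]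
    exact h _
  · intro h n
    have h1 := (hc.2 _ _).1 h (n + m₀) (Nat.le_add_left _ _)
    rw [frobPower_frobPower] at h1
    have h2 : rootHom p (k + (n + m₀)) (c * r ^ p ^ (n + m₀)) ∈ 𝔞.map (PerfectClosure.of R p) :=
      (rootHom_mem_map_of p).2 (mem_frobClosure_frobPower p |>.2 ⟨0, by simpa using h1⟩)
    rw [map_mul, rootHom_pow] at h2
    -- The test condition only supplies the deeper root ψ_{k+n+m₀}(c); ψ_n(c) is one of its powers,
    -- hence a multiple.
    have h3 : rootHom p n c = rootHom p (k + (n + m₀)) c ^ p ^ (k + m₀) := by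
      rw [← map_pow, show k + (n + m₀) = n + (k + m₀) by ring, rootHom_pow]
    rw [h3, ← Nat.sub_add_cancel (pow_pos (Fact.out : p.Prime).pos (k + m₀) :
      1 ≤ p ^ (k + m₀)), pow_succ]
    have := Ideal.mul_mem_left _ (rootHom p (k + (n + m₀)) c ^ (p ^ (k + m₀) - 1)) h2
    convert this using 1
    ring

theorem exists_primary_decomposition_testColon (c : R) {𝔄 : Ideal (PerfectClosure R p)}
    {t : Finset (Ideal (PerfectClosure R p))} (hinf : t.inf id = 𝔄) (ht : ∀ q ∈ t, q.IsPrimary) :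
    ∃ t' : Finset (Ideal (PerfectClosure R p)), t'.inf id = testColon p c 𝔄 ∧
      (∀ q ∈ t', q.IsPrimary) ∧ ∀ q ∈ t', ∃ q₀ ∈ t, q.radical = q₀.radical := by
  classical
  have key : ∀ q ∈ t, testColon p c q ≠ ⊤ →
      (testColon p c q).IsPrimary ∧ (testColon p c q).radical = q.radical := by
    intro q hq hne
    have hqp := Ideal.isPrimary_iff.1 (ht q hq)
    have hle : q ≤ testColon p c q := fun x hx =>
      mem_testColon.2 fun n => Ideal.mul_mem_right _ _ hx
    have hrad : (testColon p c q).radical = q.radical := by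
      refine le_antisymm ?_ (Ideal.radical_mono hle)
      rw [Ideal.radical_le_radical_iff]
      -- A single root of c outside q already forces the whole colon into √q.
      obtain ⟨n, hn⟩ : ∃ n, rootHom p n c ∉ q := by
        by_contra! h
        refine hne ((Ideal.eq_top_iff_one _).2 (mem_testColon.2 fun n => ?_))
        rw [one_mul]; exact h n
      intro z hz
      exact (hqp.2 (mul_comm z _ ▸ mem_testColon.1 hz n)).resolve_left hn
    refine ⟨Ideal.isPrimary_iff.2 ⟨hne, fun {x y} hxy => ?_⟩, hrad⟩
    rw [hrad]
    by_cases hy : y ∈ q.radical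
    · exact Or.inr hy
    · refine Or.inl (mem_testColon.2 fun n => ?_)
      refine (hqp.2 (?_ : x * rootHom p n c * y ∈ q)).resolve_right hy
      rw [mul_right_comm]
      exact mem_testColon.1 hxy n
  refine ⟨(t.image (testColon p c)).filter (· ≠ ⊤), ?_, fun q hq => ?_, fun q hq => ?_⟩
  · ext x
    rw [mem_testColon, ← hinf]
    simp only [Submodule.mem_finsetInf, Finset.mem_filter, Finset.mem_image, id]
    constructor
    · intro h n q hq
      by_cases hne : testColon p c q = ⊤
      · exact mem_testColon.1 (hne ▸ trivial : x ∈ testColon p c q) n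
      · exact mem_testColon.1 (h _ ⟨⟨q, hq, rfl⟩, hne⟩) n
    · rintro h _ ⟨⟨q, hq, rfl⟩, -⟩
      exact mem_testColon.2 fun n => h n q hq
  · obtain ⟨hq, hne⟩ := Finset.mem_filter.1 hq
    obtain ⟨q, hqt, rfl⟩ := Finset.mem_image.1 hq
    exact (key q hqt hne).1
  · obtain ⟨hq, hne⟩ := Finset.mem_filter.1 hq
    obtain ⟨q, hqt, rfl⟩ := Finset.mem_image.1 hq
    exact ⟨q, hqt, (key q hqt hne).2⟩

theorem HasPrimaryDecomposition.testColon (c : R) {𝔄 : Ideal (PerfectClosure R p)}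
    (h : HasPrimaryDecomposition 𝔄) : HasPrimaryDecomposition (testColon p c 𝔄) := by
  obtain ⟨t, ht, hinf⟩ := h
  obtain ⟨t', h1, h2, -⟩ := exists_primary_decomposition_testColon p c hinf ht
  exact ⟨t', h2, h1⟩

theorem associatedPrimes_testColon_subset (c : R) {𝔄 : Ideal (PerfectClosure R p)}
    (h : HasPrimaryDecomposition 𝔄) :
    Submodule.associatedPrimes (testColon p c 𝔄) ⊆ Submodule.associatedPrimes 𝔄 := by
  obtain ⟨s, hs, hinf⟩ := h
  obtain ⟨t, h1, h2, h3, h4⟩ :=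
    Submodule.exists_minimal_isPrimary_decomposition_of_isPrimary_decomposition hinf
      (fun J hJ => hs J hJ)
  have hmin : Submodule.IsMinimalPrimaryDecomposition 𝔄 t := ⟨h1, h2, h3, h4⟩
  obtain ⟨t', h1', h2', h3'⟩ := exists_primary_decomposition_testColon p c h1 (fun q hq => h2 hq)
  intro P hP
  obtain ⟨q, hq, rfl⟩ := associatedPrimes_subset_image_radical h1' h2' hP
  obtain ⟨q₀, hq₀, heq⟩ := h3' q hq
  rw [heq]
  simpa [Submodule.colon_univ] using hmin.mem_associatedPrimes hq₀

/-- Otherwise c lies in every power of a maximal ideal 𝔪, so (1 - r)c = 0 with r ∈ 𝔪 by Krull, and c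
lies in every minimal prime below 𝔪. -/
theorem tightClosure_ne_top [IsNoetherianRing R] {𝔞 : Ideal R} (h : 𝔞 ≠ ⊤) :
    tightClosure p 𝔞 ≠ ⊤ := by
  intro htop
  obtain ⟨c, hc, N, hN⟩ : (1 : R) ∈ tightClosure p 𝔞 := htop ▸ trivial
  obtain ⟨m, hm, hle⟩ := Ideal.exists_le_maximal 𝔞 h
  have hcm : ∀ n, c ∈ m ^ n := by
    intro n
    have h1 := hN (N + n) (Nat.le_add_right _ _)
    rw [one_pow, mul_one] at h1
    have h2 : frobPower p (N + n) 𝔞 ≤ m ^ n := by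
      refine Ideal.span_le.2 ?_
      rintro _ ⟨x, hx, rfl⟩
      refine Ideal.pow_le_pow_right (m := n) ?_ (Ideal.pow_mem_pow (hle hx) _)
      exact (Nat.le_add_left n N).trans (Nat.lt_pow_self (Fact.out : p.Prime).one_lt).le
    exact h2 h1
  obtain ⟨r, hr⟩ := (m.mem_iInf_smul_pow_eq_bot_iff c).1 (by
    rw [Submodule.mem_iInf]
    intro n
    simpa using hcm n)
  obtain ⟨P, hP, hPm⟩ := Ideal.exists_minimalPrimes_le (I := ⊥) (J := m) bot_le
  have h3 : (1 - (r : R)) * c = 0 := by rw [sub_mul, one_mul, ← smul_eq_mul (r : R), hr, sub_self]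
  have h4 : (1 - (r : R)) * c ∈ P := h3 ▸ zero_mem P
  rcases hP.1.1.mem_or_mem h4 with h5 | h5
  · refine hm.ne_top ((Ideal.eq_top_iff_one _).2 ?_)
    simpa using add_mem (hPm h5) r.2
  · exact hc P hP h5

end TightClosure

/-! ### Tight closure commutes with localization. -/

section Localization

variable {R : Type u} [CommRing R]

/-- If no u ∉ P were killed by a power of s, a prime avoiding s and the complement of P would lie
strictly inside P. -/
theorem exists_mem_ker_notMem_of_mem_minimalPrimes {S : Submonoid R} {P : Ideal R}
    (hP : P ∈ minimalPrimes R) {s : R} (hs : s ∈ S) (hsP : s ∈ P) :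
    ∃ u ∉ P, algebraMap R (Localization S) u = 0 := by
  have hPp : P.IsPrime := hP.1.1
  by_contra! h
  have hdisj : Disjoint ((⊥ : Ideal R) : Set R)
      ((P.primeCompl ⊔ Submonoid.powers s : Submonoid R) : Set R) := by
    rw [Set.disjoint_left]
    rintro x hx hx'
    obtain ⟨u, hu, v, ⟨k, rfl⟩, huv⟩ := Submonoid.mem_sup.1 hx'
    refine h u hu ((IsLocalization.map_eq_zero_iff S _ _).2 ⟨⟨s ^ k, pow_mem hs k⟩, ?_⟩)
    rw [mul_comm]
    exact huv.trans hx
  obtain ⟨Q, hQ, -, hQd⟩ := Ideal.exists_le_prime_disjoint _ _ hdisj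
  have hQP : Q ≤ P := fun x hx => by
    by_contra hxP
    exact Set.disjoint_left.1 hQd hx (Submonoid.mem_sup_left (show x ∈ P.primeCompl from hxP))
  exact Set.disjoint_left.1 hQd (hP.2 ⟨hQ, bot_le⟩ hQP hsP)
    (Submonoid.mem_sup_right (Submonoid.mem_powers s))

theorem algebraMap_mem_minCompl {S : Submonoid R} {c : R} (hc : c ∈ minCompl R) :
    algebraMap R (Localization S) c ∈ minCompl (Localization S) := by
  intro P hP hcP
  have h := IsLocalization.minimalPrimes_map S (Localization S) (⊥ : Ideal R)
  rw [Ideal.map_bot] at h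
  exact hc _ (h.subset hP) hcP

/-- Prime avoidance gives e in the kernel that lies in all minimal primes missing d and in none
containing d; then d + e avoids them all. -/
theorem exists_mem_minCompl_algebraMap_eq [IsNoetherianRing R] {S : Submonoid R} {d : R}
    (hd : algebraMap R (Localization S) d ∈ minCompl (Localization S)) :
    ∃ d' ∈ minCompl R, algebraMap R (Localization S) d' = algebraMap R (Localization S) d := by
  classical
  have hfin := minimalPrimes.finite_of_isNoetherianRing R
  set K := RingHom.ker (algebraMap R (Localization S))
  have hK : ∀ P ∈ minimalPrimes R, d ∈ P → ¬ K ≤ P := by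
    intro P hP hdP hKP
    have hPp : P.IsPrime := hP.1.1
    by_cases hdisj : Disjoint (S : Set R) (P : Set R)
    · refine hd (P.map (algebraMap R (Localization S))) ?_ (Ideal.mem_map_of_mem _ hdP)
      have h := IsLocalization.minimalPrimes_map S (Localization S) (⊥ : Ideal R)
      rw [Ideal.map_bot] at h
      refine h.superset ?_
      rw [Set.mem_preimage, IsLocalization.under_map_of_isPrime_disjoint S _ hPp hdisj]
      exact hP
    · obtain ⟨s, hs, hsP⟩ := Set.not_disjoint_iff.1 hdisj
      obtain ⟨u, hu, hu0⟩ := exists_mem_ker_notMem_of_mem_minimalPrimes hP hs hsP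
      exact hu (hKP hu0)
  set G := hfin.toFinset.filter (d ∉ ·)
  set B := hfin.toFinset.filter (d ∈ ·)
  have hE : ¬ ((K ⊓ G.inf id : Ideal R) : Set R) ⊆ ⋃ P ∈ (B : Set (Ideal R)), (P : Set R) := by
    rw [Ideal.subset_union_prime ⊥ ⊥ (fun P hP _ _ =>
      (hfin.mem_toFinset.1 (Finset.mem_filter.1 hP).1).1.1)]
    rintro ⟨P, hP, hle⟩
    obtain ⟨hPm, hdP⟩ := Finset.mem_filter.1 hP
    have hPm := hfin.mem_toFinset.1 hPm
    rcases hPm.1.1.inf_le.1 hle with h | h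
    · exact hK P hPm hdP h
    · obtain ⟨Q, hQ, hQP⟩ := (Ideal.IsPrime.inf_le' hPm.1.1).1 h
      obtain ⟨hQm, hdQ⟩ := Finset.mem_filter.1 hQ
      have hQm := hfin.mem_toFinset.1 hQm
      exact hdQ (hPm.2 ⟨hQm.1.1, bot_le⟩ hQP hdP)
  obtain ⟨e, ⟨heK, heG⟩, heB⟩ := Set.not_subset.1 hE
  have heK : algebraMap R (Localization S) e = 0 := heK
  refine ⟨d + e, fun P hP hmem => ?_, by rw [map_add, heK, add_zero]⟩
  by_cases hdP : d ∈ P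
  · refine heB (Set.mem_biUnion (x := P) ?_ ((Ideal.add_mem_iff_right P hdP).1 hmem))
    exact Finset.mem_coe.2 (Finset.mem_filter.2 ⟨hfin.mem_toFinset.2 hP, hdP⟩)
  · refine hdP ((Ideal.add_mem_iff_left P ?_).1 hmem)
    exact Submodule.mem_finsetInf.1 heG P (Finset.mem_filter.2 ⟨hfin.mem_toFinset.2 hP, hdP⟩)

variable (p : ℕ) [Fact p.Prime] [CharP R p]

theorem map_tightClosure_subset (S : Submonoid R) (𝔞 : Ideal R)
    [CharP (Localization S) p] {x : Localization S}
    (hx : x ∈ (tightClosure p 𝔞).map (algebraMap R (Localization S))) :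
    x ∈ tightClosureSet p (𝔞.map (algebraMap R (Localization S))) := by
  obtain ⟨⟨⟨r, hr⟩, s⟩, hrs⟩ := (IsLocalization.mem_map_algebraMap_iff S _).1 hx
  obtain ⟨c, hc, N, h⟩ := hr
  refine ⟨_, algebraMap_mem_minCompl hc, N, fun n hn => ?_⟩
  have h1 := Ideal.mem_map_of_mem (algebraMap R (Localization S)) (h n hn)
  rw [← frobPower_map, map_mul, map_pow] at h1
  dsimp only at hrs
  rw [← hrs, mul_pow, ← mul_assoc] at h1
  exact (Ideal.mul_unit_mem_iff_mem _ ((IsLocalization.map_units _ s).pow _)).1 h1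

theorem mem_map_tightClosure [IsNoetherianRing R] {m₀ : ℕ} {c : R}
    (hc : IsWeakTestElement p m₀ c) {𝔞 : Ideal R}
    (hA : HasPrimaryDecomposition (𝔞.map (PerfectClosure.of R p))) (S : Submonoid R)
    [CharP (Localization S) p] {x : Localization S}
    (hx : x ∈ tightClosureSet p (𝔞.map (algebraMap R (Localization S)))) :
    x ∈ (tightClosure p 𝔞).map (algebraMap R (Localization S)) := by
  classical
  obtain ⟨d₀, hd₀, N, hx⟩ := hx
  obtain ⟨⟨r, s⟩, hrs⟩ := IsLocalization.surj S x
  obtain ⟨⟨d₁, s₁⟩, hd₁⟩ := IsLocalization.surj S d₀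
  dsimp only at hrs hd₁
  obtain ⟨d, hd, hdd⟩ := exists_mem_minCompl_algebraMap_eq (S := S) (d := d₁) (by
    intro P hP hmem
    rw [← hd₁] at hmem
    rcases hP.1.1.mem_or_mem hmem with h | h
    · exact hd₀ P hP h
    · exact hP.1.1.ne_top (Ideal.eq_top_of_isUnit_mem _ h (IsLocalization.map_units _ s₁)))
  have hloc : ∀ n ≥ N, ∃ u ∈ S, u * (d * r ^ p ^ n) ∈ frobPower p n 𝔞 := by
    intro n hn
    have h1 : algebraMap R (Localization S) (d * r ^ p ^ n) ∈
        (frobPower p n 𝔞).map (algebraMap R (Localization S)) := by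
      rw [map_mul, map_pow, hdd, ← hd₁, ← hrs, ← frobPower_map]
      have := Ideal.mul_mem_left _ (algebraMap R (Localization S) s₁ *
        algebraMap R (Localization S) s ^ p ^ n) (hx n hn)
      convert this using 1
      ring
    obtain ⟨u, hu, h⟩ := (IsLocalization.algebraMap_mem_map_algebraMap_iff S _ _ _).1 h1
    exact ⟨u, hu, h⟩
  obtain ⟨t, ht, hinf⟩ := hA
  -- The denominators u in `hloc` depend on n. Here one v ∈ S is found for all n: it lies in every
  -- component whose radical meets S, while the other components allow u to be cancelled.
  obtain ⟨v, hv, hvt⟩ : ∃ v ∈ S, ∀ q ∈ t, (∃ u ∈ S, rootHom p 0 u ∈ q.radical) →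
      rootHom p 0 v ∈ q := by
    clear hinf
    induction t using Finset.induction_on with
    | empty => exact ⟨1, one_mem S, by simp⟩
    | insert q t _ ih =>
      obtain ⟨v, hv, hvt⟩ := ih fun q hq => ht q (Finset.mem_insert_of_mem hq)
      by_cases hq : ∃ u ∈ S, rootHom p 0 u ∈ q.radical
      · obtain ⟨u, hu, k, hk⟩ := hq
        refine ⟨u ^ k * v, mul_mem (pow_mem hu k) hv, fun q' hq' hq'' => ?_⟩
        rw [map_mul, map_pow]
        rcases Finset.mem_insert.1 hq' with rfl | hq'
        · exact Ideal.mul_mem_right _ _ hk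
        · exact Ideal.mul_mem_left _ _ (hvt q' hq' hq'')
      · refine ⟨v, hv, fun q' hq' hq'' => ?_⟩
        rcases Finset.mem_insert.1 hq' with rfl | hq'
        · exact absurd hq'' hq
        · exact hvt q' hq' hq''
  have hmem : v * r ∈ tightClosure p 𝔞 := by
    refine mem_tightClosure_of_frobClosure p hc hd N fun n hn => ?_
    rw [← rootHom_mem_map_of, ← hinf, Submodule.mem_finsetInf]
    intro q hq
    by_cases hbad : ∃ u ∈ S, rootHom p 0 u ∈ q.radical
    · rw [mul_pow, map_mul, map_mul, rootHom_pow_self]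
      exact Ideal.mul_mem_left _ _ (Ideal.mul_mem_right _ _ (hvt q hq hbad))
    · obtain ⟨u, hu, h⟩ := hloc n hn
      have h1 : rootHom p n (u * (d * r ^ p ^ n)) ∈ q := by
        have h2 := (rootHom_mem_map_of p (I := 𝔞) (n := n) (r := u * (d * r ^ p ^ n))).2
          (mem_frobClosure_frobPower p |>.2 ⟨0, by simpa using h⟩)
        rw [← hinf] at h2
        exact Submodule.mem_finsetInf.1 h2 q hq
      rw [map_mul, mul_comm] at h1
      have h3 := ((Ideal.isPrimary_iff.1 (ht q hq)).2 h1).resolve_right fun h3 => hbad ⟨u, hu, by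
        rw [← rootHom_pow_pow p n]
        exact Ideal.pow_mem_of_mem _ h3 _ (pow_pos (Fact.out : p.Prime).pos n)⟩
      rw [show d * (v * r) ^ p ^ n = v ^ p ^ n * (d * r ^ p ^ n) by ring, map_mul]
      exact Ideal.mul_mem_left _ _ h3
  refine (IsLocalization.mem_map_algebraMap_iff S _).2 ⟨⟨⟨v * r, hmem⟩, ⟨v, hv⟩ * s⟩, ?_⟩
  simp only [Submonoid.coe_mul, map_mul, ← hrs]
  ring

theorem coe_map_tightClosure [IsNoetherianRing R] {m₀ : ℕ} {c : R}
    (hc : IsWeakTestElement p m₀ c) {𝔞 : Ideal R}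
    (hA : HasPrimaryDecomposition (𝔞.map (PerfectClosure.of R p))) (S : Submonoid R) :
    (((tightClosure p 𝔞).map (algebraMap R (Localization S)) : Ideal (Localization S)) :
      Set (Localization S)) = tightClosureSet p (𝔞.map (algebraMap R (Localization S))) := by
  -- The zero ring is not of characteristic p and is treated apart; both sides are then everything.
  rcases subsingleton_or_nontrivial (Localization S) with _ | _
  · ext x
    refine ⟨fun _ => ⟨1, one_mem_minCompl, 0, fun n _ => ?_⟩, fun _ => ?_⟩
    · rw [Subsingleton.elim (1 * x ^ p ^ n) 0]; exact zero_mem _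
    · rw [Subsingleton.elim x 0]; exact zero_mem _
  · have : CharP (Localization S) p := (CharP.charP_iff_prime_eq_zero Fact.out).2 (by
      rw [← map_natCast (algebraMap R _), CharP.cast_eq_zero, map_zero])
    exact Set.Subset.antisymm (fun _ => map_tightClosure_subset p S 𝔞)
      (fun _ => mem_map_tightClosure p hc hA S)

end Localization

/-! ### The main theorem. -/

theorem theorem6p6 (p : ℕ) [Fact p.Prime]
    {R : Type*} [CommRing R] [IsNoetherianRing R] [CharP R p]
    {R'' : Type*} [CommRing R'']
    {T : Type*} [CommRing T] [IsRegularRing T] [CharP T p] [Algebra R'' T]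
    (hpure : IsPureSubring R'' T)
    (hinsep : (∃ i : R'' →+* R, IsPurelyInsepExtension p i) ∨
      (∃ i : R →+* R'', IsPurelyInsepExtension p i)) :
    -- primary decomposition of finitely generated proper ideals of the perfect closure
    (∀ 𝔄 : Ideal (PerfectClosure R p), 𝔄.FG → 𝔄 ≠ ⊤ → HasPrimaryDecomposition 𝔄) ∧
    ∀ 𝔞 : Ideal R, 𝔞 ≠ ⊤ →
      -- the `F`-closures of the Frobenius powers
      HasLinearGrowth p (fun n => frobClosure p (frobPower p n 𝔞)) ∧
      (⋃ n : ℕ, associatedPrimes R (R ⧸ frobClosure p (frobPower p n 𝔞))).Finite ∧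
      ((∃ (m₀ : ℕ) (c : R), IsWeakTestElement p m₀ c) →
        -- tight closure commutes with localization
        (∀ S : Submonoid R,
          (((tightClosure p 𝔞).map (algebraMap R (Localization S)) : Ideal (Localization S)) :
              Set (Localization S)) =
            tightClosureSet p (𝔞.map (algebraMap R (Localization S)))) ∧
        -- the tight closures of the Frobenius powers
        (∃ 𝔄 : Ideal (PerfectClosure R p),
          CorrespondsTo p 𝔄 (fun n => tightClosure p (frobPower p n 𝔞)) ∧
            HasPrimaryDecomposition 𝔄) ∧
        HasLinearGrowth p (fun n => tightClosure p (frobPower p n 𝔞)) ∧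
        (⋃ n : ℕ, associatedPrimes R (R ⧸ tightClosure p (frobPower p n 𝔞))) ⊆
          (⋃ n : ℕ, associatedPrimes R (R ⧸ frobClosure p (frobPower p n 𝔞))) ∧
        (⋃ n : ℕ, associatedPrimes R (R ⧸ tightClosure p (frobPower p n 𝔞))).Finite) := by
  have : CharP R'' p := (RingHom.charP_iff (algebraMap R'' T) hpure.injective p).2 inferInstance
  have hFG : ∀ 𝔄 : Ideal (PerfectClosure R p), 𝔄.FG → HasPrimaryDecomposition 𝔄 :=
    fun 𝔄 h => hasPrimaryDecomposition_of_fg p hpure hinsep h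
  refine ⟨fun 𝔄 h _ => hFG 𝔄 h, fun 𝔞 h𝔞 => ?_⟩
  have hA := hFG (𝔞.map (PerfectClosure.of R p)) (𝔞.fg_of_isNoetherianRing.map _)
  have hF := correspondsTo_frobClosure p 𝔞
  have hfin : (⋃ n : ℕ, associatedPrimes R (R ⧸ frobClosure p (frobPower p n 𝔞))).Finite := by
    rw [iUnion_associatedPrimes p hF]
    exact hA.finite_associatedPrimes.image _
  refine ⟨hasLinearGrowth_of_correspondsTo p hF hA (frobClosure_frobPower_ne_top p h𝔞), hfin, ?_⟩
  rintro ⟨m₀, c, hc⟩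
  have hT := correspondsTo_tightClosure p hc 𝔞
  have hsub : (⋃ n : ℕ, associatedPrimes R (R ⧸ tightClosure p (frobPower p n 𝔞))) ⊆
      (⋃ n : ℕ, associatedPrimes R (R ⧸ frobClosure p (frobPower p n 𝔞))) := by
    rw [iUnion_associatedPrimes p hF, iUnion_associatedPrimes p hT]
    exact Set.image_mono (associatedPrimes_testColon_subset p c hA)
  exact ⟨coe_map_tightClosure p hc hA, ⟨_, hT, hA.testColon p c⟩,
    hasLinearGrowth_of_correspondsTo p hT (hA.testColon p c) (fun n =>
      tightClosure_ne_top p fun h => h𝔞 (top_le_iff.1 (h ▸ frobPower_le p n 𝔞))),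
    hsub, hfin.subset hsub⟩
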